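/- Two players, Alice and Bob, face $K\ge 2$ actions for $T\ge 1$ rounds, against losses $\ell_t:[K]\to[0,1]$, $t=1,\dots,T$, fixed in advance (oblivious adversary). The players have shared randomness: independent random variables $R_1,\dots,R_T$, uniform on $[0,1]$, where $R_t$ is revealed to both at the beginning of round $t$. Then, still at the beginning of round $t$, either player may call for a communication step, in which the two instantaneously exchange bit strings; afterwards Alice picks $A_t\in[K]$ and Bob picks $B_t\in[K]$. They suffer, respectively, the losses $\max(\ell_t(A_t),\mathbf 1\{A_t=B_t\})$ and $\max(\ell_t(B_t),\mathbf 1\{A_t=B_t\})$. Each player observes only his or her own suffered loss and whether a collision $A_t=B_t$ occurred, and each decision of a player is a (measurable) function of the shared randomness revealed so far, of this player's own past observations, and of the past and current communication. The regret is \[ R_T=\max_{a\ne b}\ \mathbb E\sum_{t=1}^T\Big(\max(\ell_t(A_t),\mathbf 1\{A_t=B_t\})+\max(\ell_t(B_t),\mathbf 1\{A_t=B_t\})-\ell_t(a)-\ell_t(b)\Big). \] There is an absolute constant $C$ such that for all $K\ge 2$ and $T\ge 1$ there exists a strategy of the two players (depending only on $K$ and $T$) with the following properties, for every sequence of losses: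 1. there is no collision at all: $A_t\neq B_t$ for every $t\le T$; 2. $R_T\le 2^9K^{3/2}\log(K)\sqrt T$; 3. the expected number of rounds in which the players communicate is at most $K^{3/2}\sqrt T$; 4. at each communication step at most $C\,K\log T$ bits are exchanged in total. -/

import Mathlib

open MeasureTheory

namespace CommBandit

/-- Finite bit strings may be tested in any way. -/
instance instMeasurableSpaceBits : MeasurableSpace (List Bool) := ⊤

/-- What happens on the communication channel at the beginning of a round: either nothing,
or one communication step, in which Alice sends a bit string to Bob, Bob sends back a bit string
to Alice, and Alice sends a closing bit string to Bob. -/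
inductive Exchange where
  | silent : Exchange
  | talk (first reply closing : List Bool) : Exchange

instance instMeasurableSpaceExchange : MeasurableSpace Exchange := ⊤

/-- `1` if a communication step takes place and `0` otherwise. -/
def Exchange.count : Exchange → ℕ
  | .silent => 0
  | .talk _ _ _ => 1

/-- The number of bits exchanged, in both directions together. -/
def Exchange.bits : Exchange → ℕ
  | .silent => 0
  | .talk first reply closing => first.length + reply.length + closing.length

/-- What a player records in one round, besides the shared randomness: the exchange that took
place at the beginning of the round, the loss that the player suffered, and whether
there was a collision. -/
abbrev Obs : Type := Exchange × ℝ × Bool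

/-- What a player knows at the beginning of round `t` (rounds are `0, 1, 2, …`): the shared
random variables `R 0, …, R t`, and the player's records of the rounds `0, …, t - 1`. -/
abbrev Info (t : ℕ) : Type := (Fin (t + 1) → unitInterval) × (Fin t → Obs)

/-- A strategy for two players with communication and shared randomness, `K` actions.
At the beginning of a round each player may call for communication; a communication step takes
place as soon as one of them does. Every decision is a measurable function of what the deciding
player knows at that moment. -/
structure Strategy (K : ℕ) where
  /-- Does Alice call for communication? -/
  callA : ∀ t, Info t → Bool
  /-- Does Bob call for communication? -/
  callB : ∀ t, Info t → Bool
  /-- The first message, from Alice to Bob. -/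
  first : ∀ t, Info t → List Bool
  /-- Bob's reply, which may depend on the first message. -/
  reply : ∀ t, Info t × List Bool → List Bool
  /-- Alice's closing message, which may depend on Bob's reply. -/
  closing : ∀ t, Info t × List Bool → List Bool
  /-- Alice's action, which may depend on the exchange of the current round. -/
  actA : ∀ t, Info t × Exchange → Fin K
  /-- Bob's action, which may depend on the exchange of the current round. -/
  actB : ∀ t, Info t × Exchange → Fin K
  measurable_callA : ∀ t, Measurable (callA t)
  measurable_callB : ∀ t, Measurable (callB t)
  measurable_first : ∀ t, Measurable (first t)
  measurable_reply : ∀ t, Measurable (reply t)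
  measurable_closing : ∀ t, Measurable (closing t)
  measurable_actA : ∀ t, Measurable (actA t)
  measurable_actB : ∀ t, Measurable (actB t)

/-- The loss suffered by a player who plays `own` while the other player plays `other`:
the loss of the action, or `1` in the event of a collision. -/
noncomputable def suffered {K : ℕ} (l : Fin K → ℝ) (own other : Fin K) : ℝ :=
  max (l own) (if own = other then 1 else 0)

namespace Strategy

variable {K : ℕ} (σ : Strategy K)

/-- The exchange at the beginning of round `t`, if Alice knows `iA` and Bob knows `iB`. -/
def exchangeOf (t : ℕ) (iA iB : Info t) : Exchange :=
  if σ.callA t iA || σ.callB t iB then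
    .talk (σ.first t iA) (σ.reply t (iB, σ.first t iA))
      (σ.closing t (iA, σ.reply t (iB, σ.first t iA)))
  else .silent

/-- The actions of Alice and Bob in round `t`, if Alice knows `iA` and Bob knows `iB` at the
beginning of this round. -/
def actionsOf (t : ℕ) (iA iB : Info t) : Fin K × Fin K :=
  (σ.actA t (iA, σ.exchangeOf t iA iB), σ.actB t (iB, σ.exchangeOf t iA iB))

/-- The records of Alice and of Bob of the rounds `0, …, t - 1`, when the losses are `ℓ` and
the shared random variables are `R`. -/
noncomputable def records (ℓ : ℕ → Fin K → ℝ) (R : ℕ → unitInterval) :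
    (t : ℕ) → (Fin t → Obs) × (Fin t → Obs)
  | 0 => (Fin.elim0, Fin.elim0)
  | t + 1 =>
    let h := records ℓ R t
    let iA : Info t := (fun s => R s, h.1)
    let iB : Info t := (fun s => R s, h.2)
    let e := σ.exchangeOf t iA iB
    let a := (σ.actionsOf t iA iB).1
    let b := (σ.actionsOf t iA iB).2
    (Fin.snoc h.1 (e, suffered (ℓ t) a b, decide (a = b)),
     Fin.snoc h.2 (e, suffered (ℓ t) b a, decide (a = b)))

/-- What Alice knows at the beginning of round `t`. -/
noncomputable def infoA (ℓ : ℕ → Fin K → ℝ) (R : ℕ → unitInterval) (t : ℕ) : Info t :=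
  (fun s => R s, (σ.records ℓ R t).1)

/-- What Bob knows at the beginning of round `t`. -/
noncomputable def infoB (ℓ : ℕ → Fin K → ℝ) (R : ℕ → unitInterval) (t : ℕ) : Info t :=
  (fun s => R s, (σ.records ℓ R t).2)

/-- The exchange at the beginning of round `t`. -/
noncomputable def exchange (ℓ : ℕ → Fin K → ℝ) (R : ℕ → unitInterval) (t : ℕ) : Exchange :=
  σ.exchangeOf t (σ.infoA ℓ R t) (σ.infoB ℓ R t)

/-- Alice's action in round `t`. -/
noncomputable def alice (ℓ : ℕ → Fin K → ℝ) (R : ℕ → unitInterval) (t : ℕ) : Fin K :=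
  (σ.actionsOf t (σ.infoA ℓ R t) (σ.infoB ℓ R t)).1

/-- Bob's action in round `t`. -/
noncomputable def bob (ℓ : ℕ → Fin K → ℝ) (R : ℕ → unitInterval) (t : ℕ) : Fin K :=
  (σ.actionsOf t (σ.infoA ℓ R t) (σ.infoB ℓ R t)).2

end Strategy

/-- The law of the shared randomness: independent uniform random variables in `[0, 1]`, one for
each round. -/
noncomputable def sharedLaw : Measure (ℕ → unitInterval) :=
  Measure.infinitePi fun _ => (volume : Measure unitInterval)

namespace Strategy

variable {K : ℕ} (σ : Strategy K)

/-- The regret over the rounds `0, …, T - 1` against the losses `ℓ`: the maximum, over pairs of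
distinct actions, of the expected difference of cumulative losses. -/
noncomputable def regret (T : ℕ) (ℓ : ℕ → Fin K → ℝ) : ℝ :=
  ⨆ p : {p : Fin K × Fin K // p.1 ≠ p.2},
    ∫ R, ∑ t ∈ Finset.range T,
      (suffered (ℓ t) (σ.alice ℓ R t) (σ.bob ℓ R t)
        + suffered (ℓ t) (σ.bob ℓ R t) (σ.alice ℓ R t)
        - (ℓ t p.1.1 + ℓ t p.1.2)) ∂sharedLaw

/-- The expected number of communication steps in the rounds `0, …, T - 1`. -/
noncomputable def expectedCommunications (T : ℕ) (ℓ : ℕ → Fin K → ℝ) : ℝ :=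
  ∫ R, ∑ t ∈ Finset.range T, ((σ.exchange ℓ R t).count : ℝ) ∂sharedLaw

end Strategy

end CommBandit

/-! Exponential weights are run over unordered pairs: {a, b} is played with probability proportional
to w_a w_b, where w_a = exp(-η L_a) and L_a is an integer estimate of the cumulative loss of a. The
loss of a pair is additive, so only the inclusion probabilities `incl` matter. When L_a grows by
`gain` with probability loss/`gain`, the potential log `pairSum` gives regret at most 2 log K / η +
(η/2) Σ_t Σ_a incl_a gain_a (`sum_integral_incl_le`).

The pair law is factored into Bob's law `marg` and Alice's conditional law `cond`. Alice resamples
every round. Bob's action b is drawn from shared randomness at a communication step and then kept,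
so Alice knows it; `cond` vanishes at b, hence no collision. It depends only on counts of actions
other than b, which Alice alone records (`cond_congr`). A recorded loss changes the law that Bob
should follow, which is repaired by rejection: the recording player raises an alarm with probability
1 - `surv`. As `marg` times `surv` is proportional to the updated `marg` (`marg_mul_surv`), Bob's
action has the right law as long as there is no alarm (`integral_traj_eq`). After an alarm the
counts are exchanged and Bob's action is redrawn.

For the estimates, shared randomness singles out a uniform public action e in each round. Whoever
plays e records its loss after a thinning that makes the recording probability l_e / gain_e,
independently of b. This needs `cond` at least K/`gain`, while Σ incl_a gain_a must be O(K³). Both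
hold because `tilt` tends to give the heavier action of a pair to Bob: Alice's normalization is then
controlled by w_a and the weight `rest` of all actions but the heaviest (`mass_zero_le`). These
bounds refer to the weights at the last communication; a second kind of alarm, raised when an
estimate has moved by 1/η, keeps all weights within a factor 3 of them (`Fresh`).

Alarms of the second kind are paid for by the drift of the estimates, at most ηK per round, and
rejections cost at most 2η per round (`kern_load_le`). The choice η = 1/(K^{3/2} √T) balances
everything. -/

namespace CommBandit

/-! ### Sampling finite laws from uniform variables -/

section Sampling

variable {K : ℕ} [NeZero K]

/-- A probability vector. -/
def IsProb (v : Fin K → ℝ) : Prop := (∀ a, 0 ≤ v a) ∧ ∑ a, v a = 1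

/-- A map realizing the law takes null values only on a null set, and these are redirected to an
action of positive probability. The support condition thus holds for every `u`, so that collisions
are excluded surely and not just almost surely. -/
theorem IsProb.exists_sampler {v : Fin K → ℝ} (hv : IsProb v) :
    ∃ g : unitInterval → Fin K, Measurable g ∧ (∀ u, v (g u) ≠ 0) ∧
      ∀ a, (volume : Measure unitInterval).real (g ⁻¹' {a}) = v a := by
  obtain ⟨a₀, ha₀⟩ : ∃ a, v a ≠ 0 := by
    by_contra! h
    simpa [h] using hv.2
  let p : PMF (Fin K) := PMF.ofFintype (fun a => ENNReal.ofReal (v a)) (by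
    rw [← ENNReal.ofReal_sum_of_nonneg fun a _ => hv.1 a, hv.2, ENNReal.ofReal_one])
  obtain ⟨f, hf, hfp⟩ := Measure.exists_measurable_map_eq p.toMeasure
  have hfa : ∀ a, (volume : Measure unitInterval) (f ⁻¹' {a}) = ENNReal.ofReal (v a) := by
    intro a
    rw [← Measure.map_apply hf (measurableSet_singleton a), hfp,
      PMF.toMeasure_apply_singleton _ _ (measurableSet_singleton a)]
    rfl
  let h : Fin K → Fin K := fun a => if v a = 0 then a₀ else a
  have hne : ∀ a, v (h a) ≠ 0 := by
    intro a
    by_cases ha : v a = 0 <;> simp [h, ha, ha₀]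
  have hae : ∀ᵐ u : unitInterval, h (f u) = f u := by
    have : ∀ a, ∀ᵐ u : unitInterval, f u = a → v a ≠ 0 := by
      intro a
      by_cases ha : v a = 0
      · rw [ae_iff]
        simpa [ha, Set.preimage] using hfa a
      · exact Filter.Eventually.of_forall fun _ _ => ha
    filter_upwards [ae_all_iff.2 this] with u hu
    simp [h, hu _ rfl]
  refine ⟨h ∘ f, (measurable_of_finite h).comp hf, fun u => hne _, fun a => ?_⟩
  have : (h ∘ f) ⁻¹' {a} =ᵐ[volume] f ⁻¹' {a} := by
    filter_upwards [hae] with u hu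
    exact propext (by change h (f u) = a ↔ f u = a; rw [hu])
  rw [measureReal_def, measure_congr this, hfa, ENNReal.toReal_ofReal (hv.1 a)]

open Classical in
/-- Turns a uniform variable into a sample of the probability vector `v`. -/
noncomputable def pick (v : Fin K → ℝ) : unitInterval → Fin K :=
  if h : IsProb v then h.exists_sampler.choose else fun _ => 0

theorem measurable_pick (v : Fin K → ℝ) : Measurable (pick v) := by
  unfold pick
  split_ifs with h
  · exact h.exists_sampler.choose_spec.1
  · exact measurable_const

theorem IsProb.pick_ne_zero {v : Fin K → ℝ} (h : IsProb v) (u : unitInterval) :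
    v (pick v u) ≠ 0 := by
  rw [pick, dif_pos h]
  exact h.exists_sampler.choose_spec.2.1 u

theorem IsProb.measureReal_pick {v : Fin K → ℝ} (h : IsProb v) (a : Fin K) :
    (volume : Measure unitInterval).real (pick v ⁻¹' {a}) = v a := by
  rw [pick, dif_pos h]
  exact h.exists_sampler.choose_spec.2.2 a

theorem IsProb.integral_pick_prod {v : Fin K → ℝ} (h : IsProb v) {β : Type*} [MeasurableSpace β]
    {ν : Measure β} [SFinite ν] {H : Fin K → β → ℝ} (hH : ∀ a, Integrable (H a) ν) :
    ∫ z, H (pick v z.1) z.2 ∂((volume : Measure unitInterval).prod ν) =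
      ∑ a, v a * ∫ y, H a y ∂ν := by
  have hm : ∀ a, MeasurableSet (pick v ⁻¹' {a}) := fun a =>
    measurable_pick v (measurableSet_singleton a)
  have h1 : (fun z : unitInterval × β => H (pick v z.1) z.2) =
      fun z => ∑ a, (pick v ⁻¹' {a}).indicator (fun _ => (1 : ℝ)) z.1 * H a z.2 := by
    funext z
    rw [Finset.sum_eq_single (pick v z.1)]
    · simp
    · intro a _ ha
      simp [Set.indicator, ha.symm]
    · simp
  rw [h1, integral_finsetSum]
  · refine Finset.sum_congr rfl fun a _ => ?_
    rw [integral_prod_mul (fun u => (pick v ⁻¹' {a}).indicator (fun _ => (1 : ℝ)) u)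
      (fun y => H a y), integral_indicator_const _ (hm a), h.measureReal_pick]
    simp
  · intro a _
    exact ((integrable_const (1 : ℝ)).indicator (hm a)).mul_prod (hH a)

theorem IsProb.integral_pick {v : Fin K → ℝ} (h : IsProb v) (f : Fin K → ℝ) :
    ∫ u : unitInterval, f (pick v u) = ∑ a, v a * f a := by
  have hm : ∀ a, MeasurableSet (pick v ⁻¹' {a}) := fun a =>
    measurable_pick v (measurableSet_singleton a)
  have h1 : (fun u : unitInterval => f (pick v u)) =
      fun u => ∑ a, (pick v ⁻¹' {a}).indicator (fun _ => f a) u := by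
    funext u
    rw [Finset.sum_eq_single (pick v u)]
    · simp
    · intro a _ ha
      simp [Set.indicator, ha.symm]
    · simp
  rw [h1, integral_finsetSum _ fun a _ => (integrable_const _).indicator (hm a)]
  refine Finset.sum_congr rfl fun a _ => ?_
  rw [integral_indicator_const _ (hm a), h.measureReal_pick, smul_eq_mul]

theorem integral_ite_lt {c : ℝ} (h0 : 0 ≤ c) (h1 : c ≤ 1) (x y : ℝ) :
    ∫ u : unitInterval, (if (u : ℝ) < c then x else y) = c * x + (1 - c) * y := by
  have hm : MeasurableSet (Set.Iio (⟨c, h0, h1⟩ : unitInterval)) := measurableSet_Iio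
  have hr : (volume : Measure unitInterval).real (Set.Iio (⟨c, h0, h1⟩ : unitInterval)) = c := by
    rw [measureReal_def, unitInterval.volume_Iio, ENNReal.toReal_ofReal h0]
  have : (fun u : unitInterval => if (u : ℝ) < c then x else y) = fun u =>
      (Set.Iio (⟨c, h0, h1⟩ : unitInterval)).indicator (fun _ => x - y) u + y := by
    funext u
    by_cases hu : (u : ℝ) < c
    · have : u < ⟨c, h0, h1⟩ := hu
      simp [Set.indicator, hu, this]
    · have : ¬ u < ⟨c, h0, h1⟩ := hu
      simp [Set.indicator, hu, this]
  rw [this, integral_add ((integrable_const _).indicator hm) (integrable_const _),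
    integral_indicator_const _ hm, hr, integral_const]
  simp
  ring

/-- A single uniform variable decides whether a loss is recorded and, nested inside, whether an
alarm is raised. -/
theorem integral_nested_ite_lt {c d : ℝ} (h0 : 0 ≤ d) (hd : d ≤ c) (h1 : c ≤ 1) (x y z : ℝ) :
    ∫ u : unitInterval, (if (u : ℝ) < c then (if (u : ℝ) < d then x else y) else z) =
      d * x + (c - d) * y + (1 - c) * z := by
  have hi : ∀ (e p q : ℝ), Integrable fun u : unitInterval => if (u : ℝ) < e then p else q := by
    intro e p q
    refine Integrable.of_bound (C := max |p| |q|) (Measurable.aestronglyMeasurable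
      (Measurable.ite (measurableSet_lt measurable_subtype_coe measurable_const)
        measurable_const measurable_const)) (Filter.Eventually.of_forall fun u => ?_)
    split_ifs <;> simp
  have : (fun u : unitInterval => if (u : ℝ) < c then (if (u : ℝ) < d then x else y) else z) =
      fun u : unitInterval => (if (u : ℝ) < d then x - y else 0) +
        (if (u : ℝ) < c then y else z) := by
    funext u
    by_cases hu : (u : ℝ) < d
    · simp [hu, hu.trans_le hd]
    · simp [hu]
  rw [this, integral_add (hi _ _ _) (hi _ _ _), integral_ite_lt h0 (hd.trans h1),
    integral_ite_lt (h0.trans hd) h1]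
  ring

/-- A uniform variable carries four independent uniform variables. -/
theorem exists_split : ∃ φ : unitInterval →
    unitInterval × unitInterval × unitInterval × unitInterval,
    Measurable φ ∧ (volume : Measure unitInterval).map φ = volume :=
  Measure.exists_measurable_map_eq _

end Sampling

/-! ### Dynamical systems driven by independent variables -/

section Chain

variable {S α : Type*}

/-- The trajectory of a driven dynamical system. -/
def run (step : ℕ → S → α → S) (s₀ : S) (R : ℕ → α) : ℕ → S
  | 0 => s₀
  | t + 1 => step t (run step s₀ R t) (R t)

variable {step : ℕ → S → α → S} {s₀ : S}

theorem run_congr {R R' : ℕ → α} {t : ℕ} (h : ∀ i < t, R i = R' i) :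
    run step s₀ R t = run step s₀ R' t := by
  induction t with
  | zero => rfl
  | succ t ih =>
    rw [run, run, ih fun i hi => h i (by omega), h t (by omega)]

theorem finite_range_run (hfin : ∀ t s, (Set.range (step t s)).Finite) (t : ℕ) :
    (Set.range fun R => run step s₀ R t).Finite := by
  induction t with
  | zero => exact (Set.finite_singleton s₀).subset (by rintro _ ⟨R, rfl⟩; rfl)
  | succ t ih =>
    refine (ih.biUnion fun s _ => hfin t s).subset ?_
    rintro _ ⟨R, rfl⟩
    exact Set.mem_biUnion ⟨R, rfl⟩ ⟨R t, rfl⟩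

variable [Countable S] [MeasurableSpace S] [DiscreteMeasurableSpace S] [MeasurableSpace α]

theorem measurable_run (hstep : ∀ t s, Measurable (step t s)) (t : ℕ) :
    Measurable fun R => run step s₀ R t := by
  induction t with
  | zero => exact measurable_const
  | succ t ih =>
    have : Measurable fun p : S × α => step t p.1 p.2 := measurable_from_prod_countable_right (hstep t)
    exact this.comp (ih.prodMk (measurable_pi_apply t))

variable {ν : Measure α} [IsProbabilityMeasure ν]

/-- The state at time `t` depends only on coordinates before `t`; `ext` fills the others with an
arbitrary value. -/
theorem indepFun_run (hstep : ∀ t s, Measurable (step t s)) (t : ℕ) :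
    ProbabilityTheory.IndepFun (fun R => run step s₀ R t) (fun R => R t)
      (Measure.infinitePi fun _ : ℕ => ν) := by
  obtain ⟨r₀⟩ : Nonempty α := ν.nonempty_of_neZero
  have h := (ProbabilityTheory.iIndepFun_infinitePi (P := fun _ : ℕ => ν)
    (X := fun _ x => x) fun _ => measurable_id).indepFun_finset (Finset.range t) {t}
      (by simp) fun i => measurable_pi_apply i
  let ext : (Finset.range t → α) → ℕ → α :=
    fun r i => if h : i ∈ Finset.range t then r ⟨i, h⟩ else r₀
  have hext : Measurable ext := by
    refine measurable_pi_iff.2 fun i => ?_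
    by_cases hi : i ∈ Finset.range t
    · simp only [ext, dif_pos hi]
      exact measurable_pi_apply (X := fun _ : Finset.range t => α) ⟨i, hi⟩
    · simp only [ext, dif_neg hi]
      exact measurable_const
  have h2 := h.comp (φ := fun r => run step s₀ (ext r) t) (ψ := fun r => r ⟨t, by simp⟩)
    ((measurable_run hstep t).comp hext)
    (measurable_pi_apply (X := fun _ : ({t} : Finset ℕ) => α) ⟨t, by simp⟩)
  convert h2 using 1
  · funext R
    exact run_congr fun i hi => by simp [ext, hi]
  · rfl

/-- Finitely many states are reachable, so the integrand is a finite sum of products of a state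
indicator and a function of the fresh variable, and independence applies to each product. -/
theorem integrable_run_prod (hstep : ∀ t s, Measurable (step t s))
    (hfin : ∀ t s, (Set.range (step t s)).Finite) (t : ℕ) {F : S → α → ℝ}
    (hF : ∀ s, Integrable (F s) ν) :
    Integrable (fun R => F (run step s₀ R t) (R t)) (Measure.infinitePi fun _ : ℕ => ν) ∧
    ∫ R, F (run step s₀ R t) (R t) ∂(Measure.infinitePi fun _ : ℕ => ν) =
      ∫ R, (∫ r, F (run step s₀ R t) r ∂ν) ∂(Measure.infinitePi fun _ : ℕ => ν) := by
  classical
  set P := Measure.infinitePi fun _ : ℕ => ν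
  have hX := measurable_run (s₀ := s₀) hstep t
  set X := fun R => run step s₀ R t
  set B := (finite_range_run (s₀ := s₀) hfin t).toFinset
  have hB : ∀ R, X R ∈ B := fun R => by simp [B, X]
  have hI : ∀ s, Integrable (fun R => ({s} : Set S).indicator (fun _ => (1 : ℝ)) (X R)) P := fun s =>
    (integrable_const (1 : ℝ)).indicator (hX (MeasurableSet.of_discrete (s := {s})))
  have hFt : ∀ s, Integrable (fun R : ℕ → α => F s (R t)) P := fun s =>
    (measurePreserving_eval_infinitePi (fun _ : ℕ => ν) t).integrable_comp_of_integrable (hF s)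
  have hdec : ∀ R (G : S → ℝ), G (X R) =
      ∑ s ∈ B, ({s} : Set S).indicator (fun _ => (1 : ℝ)) (X R) * G s := by
    intro R G
    rw [Finset.sum_eq_single (X R)]
    · simp
    · intro s _ hs
      simp [Set.indicator, hs.symm]
    · exact fun h => absurd (hB R) h
  have hmulI : ∀ s, Integrable (fun R => ({s} : Set S).indicator (fun _ => (1 : ℝ)) (X R) *
      F s (R t)) P := fun s => by
    refine (hFt s).bdd_mul (c := 1) (hI s).aestronglyMeasurable (Filter.Eventually.of_forall fun R => ?_)
    by_cases h : X R = s <;> simp [Set.indicator, h]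
  have e1 : (fun R => F (X R) (R t)) =
      fun R => ∑ s ∈ B, ({s} : Set S).indicator (fun _ => (1 : ℝ)) (X R) * F s (R t) :=
    funext fun R => hdec R fun s => F s (R t)
  have e2 : (fun R => ∫ r, F (X R) r ∂ν) =
      fun R => ∑ s ∈ B, ({s} : Set S).indicator (fun _ => (1 : ℝ)) (X R) * ∫ r, F s r ∂ν :=
    funext fun R => hdec R fun s => ∫ r, F s r ∂ν
  change Integrable (fun R => F (X R) (R t)) P ∧ ∫ R, F (X R) (R t) ∂P = ∫ R, (∫ r, F (X R) r ∂ν) ∂P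
  rw [e1, e2]
  refine ⟨integrable_finsetSum _ fun s _ => hmulI s, ?_⟩
  rw [integral_finsetSum _ fun s _ => hmulI s,
    integral_finsetSum _ fun s _ => (hI s).mul_const _]
  refine Finset.sum_congr rfl fun s _ => ?_
  rw [integral_mul_const]
  have hev := (measurePreserving_eval_infinitePi (fun _ : ℕ => ν) t)
  have hFm : AEStronglyMeasurable (F s) (P.map fun R => R t) := by
    rw [hev.map_eq]
    exact (hF s).aestronglyMeasurable
  rw [(indepFun_run hstep t).integral_fun_comp_mul_comp (g := F s) hX.aemeasurable
    (measurable_pi_apply t).aemeasurable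
    (f := ({s} : Set S).indicator fun _ => (1 : ℝ))
    (Measurable.of_discrete.aestronglyMeasurable) hFm]
  congr 1
  rw [← integral_map hev.measurable.aemeasurable hFm, hev.map_eq]

end Chain

/-! ### Exponential weights over pairs and their potential -/

section Weights

variable {K : ℕ} (η : ℝ)

/-- The exponential weight of an action with cumulative loss estimate `L a`. -/
noncomputable def wt (L : Fin K → ℕ) (a : Fin K) : ℝ := Real.exp (-(η * L a))

/-- The sum of the products of the weights over all ordered pairs of distinct actions. -/
noncomputable def pairSum (L : Fin K → ℕ) : ℝ := (∑ a, wt η L a) ^ 2 - ∑ a, wt η L a ^ 2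

/-- The probability that `a` belongs to a random pair, drawn proportionally to the product of
the two weights. -/
noncomputable def incl (L : Fin K → ℕ) (a : Fin K) : ℝ :=
  2 * wt η L a * (∑ c, wt η L c - wt η L a) / pairSum η L

theorem wt_pos (L : Fin K → ℕ) (a : Fin K) : 0 < wt η L a := Real.exp_pos _

theorem sum_wt_sub (L : Fin K → ℕ) (a : Fin K) :
    ∑ c, wt η L c - wt η L a = ∑ c ∈ Finset.univ.erase a, wt η L c := by
  rw [← Finset.add_sum_erase _ _ (Finset.mem_univ a)]
  ring

theorem wt_le_sum_sub (L : Fin K → ℕ) {a b : Fin K} (h : a ≠ b) :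
    wt η L a ≤ ∑ c, wt η L c - wt η L b := by
  rw [sum_wt_sub]
  exact Finset.single_le_sum (fun c _ => (wt_pos η L c).le)
    (Finset.mem_erase.2 ⟨h, Finset.mem_univ a⟩)

theorem sum_wt_sub_nonneg (L : Fin K → ℕ) (a : Fin K) : 0 ≤ ∑ c, wt η L c - wt η L a := by
  rw [sum_wt_sub]
  exact Finset.sum_nonneg fun c _ => (wt_pos η L c).le

theorem pairSum_eq (L : Fin K → ℕ) :
    pairSum η L = ∑ b, wt η L b * (∑ c, wt η L c - wt η L b) := by
  simp only [pairSum, mul_sub, Finset.sum_sub_distrib, ← Finset.sum_mul, sq]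

theorem two_mul_wt_mul_wt_le_pairSum (L : Fin K → ℕ) {a b : Fin K} (h : a ≠ b) :
    2 * (wt η L a * wt η L b) ≤ pairSum η L := by
  rw [pairSum_eq]
  have h1 : ∀ c, 0 ≤ wt η L c * (∑ d, wt η L d - wt η L c) := fun c =>
    mul_nonneg (wt_pos η L c).le (sum_wt_sub_nonneg η L c)
  have h2 := Finset.add_le_sum (s := Finset.univ) (fun c _ => h1 c) (Finset.mem_univ a)
    (Finset.mem_univ b) h
  have h3 := mul_le_mul_of_nonneg_left (wt_le_sum_sub η L h) (wt_pos η L b).le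
  have h4 := mul_le_mul_of_nonneg_left (wt_le_sum_sub η L h.symm) (wt_pos η L a).le
  linarith

theorem pairSum_pos (hK : 2 ≤ K) (L : Fin K → ℕ) : 0 < pairSum η L := by
  have h := two_mul_wt_mul_wt_le_pairSum η L (a := ⟨0, by omega⟩) (b := ⟨1, by omega⟩) (by simp)
  have := mul_pos (wt_pos η L ⟨0, by omega⟩) (wt_pos η L ⟨1, by omega⟩)
  linarith

theorem incl_nonneg (hK : 2 ≤ K) (L : Fin K → ℕ) (a : Fin K) : 0 ≤ incl η L a :=
  div_nonneg (mul_nonneg (mul_nonneg zero_le_two (wt_pos η L a).le) (sum_wt_sub_nonneg η L a))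
    (pairSum_pos η hK L).le

theorem sum_incl (hK : 2 ≤ K) (L : Fin K → ℕ) : ∑ a, incl η L a = 2 := by
  have h : ∑ a, incl η L a = 2 * pairSum η L / pairSum η L := by
    unfold incl
    rw [← Finset.sum_div, pairSum_eq, Finset.mul_sum]
    simp only [mul_assoc]
  rw [h, mul_div_cancel_right₀ _ (pairSum_pos η hK L).ne']

theorem wt_update (L : Fin K → ℕ) (e : Fin K) (g : ℕ) (a : Fin K) :
    wt η (Function.update L e (L e + g)) a =
      if a = e then wt η L e * Real.exp (-(η * g)) else wt η L a := by
  split_ifs with h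
  · subst h
    simp only [wt, Function.update_self, ← Real.exp_add]
    push_cast
    congr 1
    ring
  · simp [wt, h]

theorem sum_comp_wt_update (F : ℝ → ℝ) (L : Fin K → ℕ) (e : Fin K) (g : ℕ) :
    ∑ a, F (wt η (Function.update L e (L e + g)) a) =
      ∑ a, F (wt η L a) - F (wt η L e) + F (wt η L e * Real.exp (-(η * g))) := by
  simp only [wt_update]
  rw [← Finset.add_sum_erase _ _ (Finset.mem_univ e),
    ← Finset.add_sum_erase Finset.univ (fun a => F (wt η L a)) (Finset.mem_univ e), if_pos rfl,
    Finset.sum_congr rfl fun a ha => by rw [if_neg (Finset.ne_of_mem_erase ha)]]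
  ring

/-- All pairs containing `e` shrink by the same factor, and `incl` is their share of the sum. -/
theorem pairSum_update (hK : 2 ≤ K) (L : Fin K → ℕ) (e : Fin K) (g : ℕ) :
    pairSum η (Function.update L e (L e + g)) =
      pairSum η L * (1 - incl η L e * (1 - Real.exp (-(η * g)))) := by
  have hZ := (pairSum_pos η hK L).ne'
  have h : incl η L e * pairSum η L = 2 * wt η L e * (∑ c, wt η L c - wt η L e) :=
    div_mul_cancel₀ _ hZ
  have h1 := sum_comp_wt_update η (fun x => x) L e g
  have h2 := sum_comp_wt_update η (fun x => x ^ 2) L e g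
  have e1 : pairSum η L * (1 - incl η L e * (1 - Real.exp (-(η * g)))) = pairSum η L -
      (incl η L e * pairSum η L) * (1 - Real.exp (-(η * g))) := by ring
  rw [e1, h, pairSum, pairSum, h1, h2]
  ring

theorem pairSum_zero_le : pairSum η (fun _ : Fin K => 0) ≤ (K : ℝ) ^ 2 := by
  simp only [pairSum, wt, Nat.cast_zero, mul_zero, neg_zero, Real.exp_zero, Finset.sum_const,
    Finset.card_univ, Fintype.card_fin, nsmul_eq_mul, mul_one]
  have : (0 : ℝ) ≤ K := Nat.cast_nonneg K
  simp

theorem neg_le_log_pairSum (L : Fin K → ℕ) {a b : Fin K} (h : a ≠ b) :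
    -(η * L a + η * L b) ≤ Real.log (pairSum η L) := by
  have h1 : wt η L a * wt η L b = Real.exp (-(η * L a + η * L b)) := by
    rw [wt, wt, ← Real.exp_add]
    congr 1
    ring
  rw [← Real.log_exp (-(η * L a + η * L b)), ← h1]
  have h2 := mul_pos (wt_pos η L a) (wt_pos η L b)
  exact Real.log_le_log h2 (by linarith [two_mul_wt_mul_wt_le_pairSum η L h])

theorem exp_neg_le_quadratic {x : ℝ} (hx : 0 ≤ x) : Real.exp (-x) ≤ 1 - x + x ^ 2 / 2 := by
  have hd : ∀ y : ℝ, HasDerivAt (fun y => 1 - y + y ^ 2 / 2 - Real.exp (-y))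
      (-1 + y + Real.exp (-y)) y := by
    intro y
    have h1 := ((hasDerivAt_const y (1 : ℝ)).sub (hasDerivAt_id y)).add
      (((hasDerivAt_id y).pow 2).div_const 2)
    have h2 := (hasDerivAt_id y).neg.exp
    refine HasDerivAt.congr_deriv (f := fun y => 1 - y + y ^ 2 / 2 - Real.exp (-y)) (h1.sub h2) ?_
    simp
  have hmono : MonotoneOn (fun y : ℝ => 1 - y + y ^ 2 / 2 - Real.exp (-y)) (Set.Ici 0) := by
    refine monotoneOn_of_deriv_nonneg (convex_Ici 0)
      (fun y _ => (hd y).continuousAt.continuousWithinAt)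
      (fun y _ => (hd y).differentiableAt.differentiableWithinAt) fun y _ => ?_
    rw [(hd y).deriv]
    linarith [Real.add_one_le_exp (-y)]
  have := hmono (Set.self_mem_Ici) (Set.mem_Ici.2 hx) hx
  simp at this
  linarith

/-- One step of the potential argument: log x ≤ x - 1 and the quadratic bound on exp(-x), which is
valid for all x ≥ 0, so that `η * g` need not be small. -/
theorem log_pairSum_update_le (hη : 0 ≤ η) (hK : 2 ≤ K) (L : Fin K → ℕ) (e : Fin K) (g : ℕ) :
    Real.log (pairSum η (Function.update L e (L e + g))) ≤
      Real.log (pairSum η L) - incl η L e * (η * g - (η * g) ^ 2 / 2) := by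
  have hpos := pairSum_pos η hK (Function.update L e (L e + g))
  rw [pairSum_update η hK] at hpos ⊢
  have h1 := pairSum_pos η hK L
  have h2 := pos_of_mul_pos_right hpos h1.le
  rw [Real.log_mul h1.ne' h2.ne']
  have h3 := Real.log_le_sub_one_of_pos h2
  have h4 := mul_le_mul_of_nonneg_left
    (exp_neg_le_quadratic (mul_nonneg hη (Nat.cast_nonneg (α := ℝ) g))) (incl_nonneg η hK L e)
  linarith

end Weights

/-! ### Splitting an unordered pair between the two players -/

section Split

variable {K : ℕ} (η : ℝ)

/-- How the pair `{a, b}` is split into the orders `(b, a)` and `(a, b)`. -/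
noncomputable def tilt (M : Fin K → ℕ) (b a : Fin K) : ℝ :=
  if a = b then 0 else 2 * wt η M b / (wt η M a + wt η M b)

theorem tilt_self (M : Fin K → ℕ) (b : Fin K) : tilt η M b b = 0 := if_pos rfl

theorem tilt_pos (M : Fin K → ℕ) {a b : Fin K} (h : a ≠ b) : 0 < tilt η M b a := by
  rw [tilt, if_neg h]
  have := wt_pos η M a
  have := wt_pos η M b
  positivity

theorem tilt_nonneg (M : Fin K → ℕ) (b a : Fin K) : 0 ≤ tilt η M b a := by
  by_cases h : a = b
  · rw [tilt, if_pos h]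
  · exact (tilt_pos η M h).le

/-- The two orders of a pair have constant total weight, so the tilt does not affect the law of the
unordered pair. -/
theorem tilt_add_tilt (M : Fin K → ℕ) (a b : Fin K) :
    tilt η M b a + tilt η M a b = if a = b then 0 else 2 := by
  by_cases h : a = b
  · simp [tilt, h]
  · rw [tilt, tilt, if_neg h, if_neg (Ne.symm h), if_neg h]
    have := wt_pos η M a
    have := wt_pos η M b
    field_simp
    ring

/-- One more observed loss of `e`. -/
def hit (n : Fin K → ℕ) (e : Fin K) : Fin K → ℕ := Function.update n e (n e + 1)

theorem sum_sum_tilt (M : Fin K → ℕ) (w l : Fin K → ℝ) :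
    ∑ b, ∑ a, tilt η M b a * (w a * w b) * (l b + l a) =
      ∑ a, 2 * w a * (∑ c, w c - w a) * l a := by
  have h1 : ∑ b, ∑ a, tilt η M b a * (w a * w b) * (l b + l a) =
      ∑ b, ∑ a, (tilt η M b a + tilt η M a b) * (w a * w b) * l a := by
    have h2 : ∑ b, ∑ a, tilt η M b a * (w a * w b) * l b =
        ∑ b, ∑ a, tilt η M a b * (w a * w b) * l a := by
      rw [Finset.sum_comm]
      refine Finset.sum_congr rfl fun b _ => Finset.sum_congr rfl fun a _ => ?_
      ring
    simp only [mul_add, Finset.sum_add_distrib, add_mul]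
    rw [h2, add_comm]
  rw [h1, Finset.sum_comm]
  refine Finset.sum_congr rfl fun a _ => ?_
  simp only [tilt_add_tilt]
  rw [← Finset.add_sum_erase _ _ (Finset.mem_univ a), if_pos rfl,
    Finset.sum_congr rfl fun b hb => by rw [if_neg (Finset.ne_of_mem_erase hb).symm],
    ← Finset.add_sum_erase _ w (Finset.mem_univ a), zero_mul, zero_mul, zero_add,
    add_sub_cancel_left, Finset.mul_sum, Finset.sum_mul]
  refine Finset.sum_congr rfl fun b _ => ?_
  ring

end Split

/-! ### Laws of the actions between two communication steps -/

section Phase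

variable {K : ℕ} [NeZero K] (η : ℝ)

theorem exists_lead (M : Fin K → ℕ) : ∃ i, ∀ a, wt η M a ≤ wt η M i :=
  Finite.exists_max (wt η M)

/-- An action of maximal weight. -/
noncomputable def lead (M : Fin K → ℕ) : Fin K := (exists_lead η M).choose

theorem wt_le_wt_lead (M : Fin K → ℕ) (a : Fin K) : wt η M a ≤ wt η M (lead η M) :=
  (exists_lead η M).choose_spec a

/-- The total weight of all actions but a heaviest one. -/
noncomputable def rest (M : Fin K → ℕ) : ℝ := ∑ c, wt η M c - wt η M (lead η M)

/-- The increment of the loss estimate of `a` caused by one observed loss. -/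
noncomputable def gain (M : Fin K → ℕ) (a : Fin K) : ℕ :=
  ⌈3 * K * (K + rest η M / wt η M a)⌉₊

/-- The loss estimates when, since they were equal to `M`, the losses `n` have been observed. -/
noncomputable def total (M n : Fin K → ℕ) : Fin K → ℕ := fun a => M a + gain η M a * n a

/-- The normalization of Alice's law when Bob plays `b`. -/
noncomputable def mass (M n : Fin K → ℕ) (b : Fin K) : ℝ :=
  ∑ a, tilt η M b a * wt η (total η M n) a

/-- The law of Alice's action when Bob plays `b`. -/
noncomputable def cond (M n : Fin K → ℕ) (b a : Fin K) : ℝ :=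
  tilt η M b a * wt η (total η M n) a / mass η M n b

/-- The law of Bob's action. -/
noncomputable def marg (M n : Fin K → ℕ) (b : Fin K) : ℝ :=
  wt η (total η M n) b * mass η M n b / pairSum η (total η M n)

/-- The probability that Bob keeps his action `b` when a loss of `e` is observed. -/
noncomputable def surv (M n : Fin K → ℕ) (b e : Fin K) : ℝ :=
  if e = b then Real.exp (-(η * gain η M b)) else mass η M (hit n e) b / mass η M n b

theorem mass_pos (hK : 2 ≤ K) (M n : Fin K → ℕ) (b : Fin K) : 0 < mass η M n b := by
  obtain ⟨a, ha⟩ : ∃ a, a ≠ b := by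
    have : Nontrivial (Fin K) := Fin.nontrivial_iff_two_le.2 hK
    exact exists_ne b
  refine Finset.sum_pos' (fun c _ => mul_nonneg (tilt_nonneg η M b c) (wt_pos η _ c).le)
    ⟨a, Finset.mem_univ a, mul_pos (tilt_pos η M ha) (wt_pos η _ a)⟩

theorem cond_nonneg (hK : 2 ≤ K) (M n : Fin K → ℕ) (b a : Fin K) : 0 ≤ cond η M n b a :=
  div_nonneg (mul_nonneg (tilt_nonneg η M b a) (wt_pos η _ a).le) (mass_pos η hK M n b).le

theorem cond_pos (hK : 2 ≤ K) (M n : Fin K → ℕ) {a b : Fin K} (h : a ≠ b) :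
    0 < cond η M n b a :=
  div_pos (mul_pos (tilt_pos η M h) (wt_pos η _ a)) (mass_pos η hK M n b)

theorem cond_self (M n : Fin K → ℕ) (b : Fin K) : cond η M n b b = 0 := by
  simp [cond, tilt_self]

theorem isProb_cond (hK : 2 ≤ K) (M n : Fin K → ℕ) (b : Fin K) : IsProb (cond η M n b) := by
  refine ⟨cond_nonneg η hK M n b, ?_⟩
  simp only [cond]
  rw [← Finset.sum_div]
  exact div_self (mass_pos η hK M n b).ne'

theorem marg_mul_cond (hK : 2 ≤ K) (M n : Fin K → ℕ) (b a : Fin K) :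
    marg η M n b * cond η M n b a = tilt η M b a *
      (wt η (total η M n) a * wt η (total η M n) b) / pairSum η (total η M n) := by
  have := (mass_pos η hK M n b).ne'
  have := (pairSum_pos η hK (total η M n)).ne'
  rw [marg, cond]
  field_simp

/-- The two losses enter symmetrically, so the tilt cancels and only the inclusion probabilities
remain. -/
theorem sum_marg_mul (hK : 2 ≤ K) (M n : Fin K → ℕ) (l : Fin K → ℝ) :
    ∑ b, marg η M n b * (l b + ∑ a, cond η M n b a * l a) =
      ∑ a, incl η (total η M n) a * l a := by
  have h1 : ∀ b, marg η M n b * (l b + ∑ a, cond η M n b a * l a) =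
      (∑ a, tilt η M b a * (wt η (total η M n) a * wt η (total η M n) b) * (l b + l a)) /
        pairSum η (total η M n) := by
    intro b
    have : l b = ∑ a, cond η M n b a * l b := by
      rw [← Finset.sum_mul, (isProb_cond η hK M n b).2, one_mul]
    conv_lhs => rw [this]
    rw [← Finset.sum_add_distrib, Finset.mul_sum, Finset.sum_div]
    refine Finset.sum_congr rfl fun a _ => ?_
    rw [← mul_add, ← mul_assoc, marg_mul_cond η hK]
    ring
  rw [Finset.sum_congr rfl fun b _ => h1 b, ← Finset.sum_div, sum_sum_tilt, Finset.sum_div]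
  refine Finset.sum_congr rfl fun a _ => ?_
  rw [incl]
  ring

theorem isProb_marg (hK : 2 ≤ K) (M n : Fin K → ℕ) : IsProb (marg η M n) := by
  refine ⟨fun b => div_nonneg (mul_nonneg (wt_pos η _ b).le (mass_pos η hK M n b).le)
    (pairSum_pos η hK _).le, ?_⟩
  have h := sum_marg_mul η hK M n fun _ => 1
  simp only [mul_one, (isProb_cond η hK M n _).2, sum_incl η hK] at h
  rw [← Finset.sum_mul] at h
  linarith

theorem total_hit (M n : Fin K → ℕ) (e : Fin K) :
    total η M (hit n e) = Function.update (total η M n) e (total η M n e + gain η M e) := by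
  funext a
  by_cases h : a = e
  · subst h
    simp [total, hit]
    ring
  · simp [total, hit, h]

theorem total_zero (M : Fin K → ℕ) : total η M (fun _ => 0) = M := by
  funext a
  simp [total]

theorem wt_total_hit (M n : Fin K → ℕ) (e a : Fin K) : wt η (total η M (hit n e)) a =
    if a = e then wt η (total η M n) e * Real.exp (-(η * gain η M e))
      else wt η (total η M n) a := by
  rw [total_hit, wt_update]

/-- The tilt vanishes at `b`, so the count of Bob's own action, which Alice does not see, is
irrelevant to her. -/
theorem mass_congr {M n n' : Fin K → ℕ} {b : Fin K} (h : ∀ a, a ≠ b → n a = n' a) :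
    mass η M n b = mass η M n' b := by
  refine Finset.sum_congr rfl fun a _ => ?_
  by_cases hab : a = b
  · rw [tilt, if_pos hab, zero_mul, zero_mul]
  · simp [wt, total, h a hab]

theorem cond_congr {M n n' : Fin K → ℕ} {b : Fin K} (h : ∀ a, a ≠ b → n a = n' a) :
    cond η M n b = cond η M n' b := by
  funext a
  rw [cond, cond, mass_congr η h]
  by_cases hab : a = b
  · rw [tilt, if_pos hab, zero_mul, zero_mul]
  · simp [wt, total, h a hab]

/-- Together with the case `e = b`, where only the base enters, this lets the recording player
compute the survival probability from private counts. -/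
theorem surv_congr {M n n' : Fin K → ℕ} {b : Fin K} (h : ∀ a, a ≠ b → n a = n' a) (e : Fin K) :
    surv η M n b e = surv η M n' b e := by
  rw [surv, surv, mass_congr η h, mass_congr η (n := hit n e) (n' := hit n' e)]
  intro a ha
  by_cases hae : a = e
  · subst hae
    simp [hit, h a ha]
  · simp [hit, hae, h a ha]

/-- Rejection sampling: the last factor does not depend on `b`, so conditioning on survival turns
Bob's old law into the one for the updated estimates. -/
theorem marg_mul_surv (hK : 2 ≤ K) (M n : Fin K → ℕ) (b e : Fin K) :
    marg η M n b * surv η M n b e = marg η M (hit n e) b *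
      (pairSum η (total η M (hit n e)) / pairSum η (total η M n)) := by
  have h1 := (mass_pos η hK M n b).ne'
  have h2 := (pairSum_pos η hK (total η M n)).ne'
  have h3 := (pairSum_pos η hK (total η M (hit n e))).ne'
  rw [marg, marg, surv]
  split_ifs with h
  · subst h
    rw [mass_congr η (n := hit n e) (n' := n) fun a ha => by simp [hit, ha], wt_total_hit,
      if_pos rfl]
    field_simp
  · rw [wt_total_hit, if_neg (Ne.symm h)]
    field_simp

theorem mass_hit (M n : Fin K → ℕ) (b e : Fin K) :
    mass η M (hit n e) b = mass η M n b -
      tilt η M b e * wt η (total η M n) e * (1 - Real.exp (-(η * gain η M e))) := by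
  simp only [mass, wt_total_hit]
  rw [← Finset.add_sum_erase _ _ (Finset.mem_univ e),
    ← Finset.add_sum_erase Finset.univ (fun a => tilt η M b a * wt η (total η M n) a)
      (Finset.mem_univ e), if_pos rfl,
    Finset.sum_congr rfl fun a ha => by rw [if_neg (Finset.ne_of_mem_erase ha)]]
  ring

/-- Given Bob's action, the fraction of weight lost is the conditional probability that `e` is in
the pair times the relative drop of the weight of `e`. -/
theorem one_sub_surv (hK : 2 ≤ K) (M n : Fin K → ℕ) (b e : Fin K) :
    1 - surv η M n b e = (if e = b then 1 else cond η M n b e) *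
      (1 - Real.exp (-(η * gain η M e))) := by
  rw [surv]
  split_ifs with h
  · rw [h, one_mul]
  · rw [mass_hit, cond]
    have := (mass_pos η hK M n b).ne'
    field_simp
    ring

theorem surv_nonneg (hK : 2 ≤ K) (M n : Fin K → ℕ) (b e : Fin K) : 0 ≤ surv η M n b e := by
  rw [surv]
  split_ifs
  · exact (Real.exp_pos _).le
  · exact div_nonneg (mass_pos η hK _ _ b).le (mass_pos η hK _ _ b).le

theorem surv_le_one (hη : 0 ≤ η) (hK : 2 ≤ K) (M n : Fin K → ℕ) (b e : Fin K) :
    surv η M n b e ≤ 1 := by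
  have h := one_sub_surv η hK M n b e
  have h1 : Real.exp (-(η * gain η M e)) ≤ 1 := Real.exp_le_one_iff.2 (by
    have : (0 : ℝ) ≤ gain η M e := Nat.cast_nonneg _
    nlinarith)
  have h2 : 0 ≤ (if e = b then 1 else cond η M n b e) := by
    split_ifs
    · exact zero_le_one
    · exact cond_nonneg η hK M n b e
  nlinarith

theorem one_sub_surv_le (hK : 2 ≤ K) (M n : Fin K → ℕ) (b e : Fin K) :
    1 - surv η M n b e ≤ (if e = b then 1 else cond η M n b e) * (η * gain η M e) := by
  rw [one_sub_surv η hK]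
  refine mul_le_mul_of_nonneg_left ?_ ?_
  · linarith [Real.add_one_le_exp (-(η * gain η M e))]
  · split_ifs
    · exact zero_le_one
    · exact cond_nonneg η hK M n b e

end Phase

/-! ### Gains against sampling probabilities -/

section Bounds

variable {K : ℕ} [NeZero K] (η : ℝ)

/-- No loss estimate has changed substantially. -/
def Fresh (M n : Fin K → ℕ) : Prop := ∀ a, η * gain η M a * n a < 1

theorem fresh_zero (M : Fin K → ℕ) : Fresh η M fun _ => 0 := fun a => by simp

theorem rest_nonneg (M : Fin K → ℕ) : 0 ≤ rest η M := sum_wt_sub_nonneg η M _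

theorem le_gain (M : Fin K → ℕ) (a : Fin K) :
    3 * K * (K + rest η M / wt η M a) ≤ (gain η M a : ℝ) := Nat.le_ceil _

theorem gain_le (M : Fin K → ℕ) (a : Fin K) :
    (gain η M a : ℝ) ≤ 3 * K * (K + rest η M / wt η M a) + 1 :=
  (Nat.ceil_lt_add_one (by
    have := rest_nonneg η M
    have := wt_pos η M a
    positivity)).le

theorem three_mul_sq_le_gain (M : Fin K → ℕ) (a : Fin K) : 3 * (K : ℝ) ^ 2 ≤ gain η M a := by
  refine le_trans ?_ (le_gain η M a)
  have h : 0 ≤ (K : ℝ) * (rest η M / wt η M a) :=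
    mul_nonneg (Nat.cast_nonneg K) (div_nonneg (rest_nonneg η M) (wt_pos η M a).le)
  nlinarith

theorem one_le_natCast (K : ℕ) [NeZero K] : (1 : ℝ) ≤ K := by
  exact_mod_cast Nat.one_le_iff_ne_zero.2 (NeZero.ne K)

theorem gain_pos (M : Fin K → ℕ) (a : Fin K) : (0 : ℝ) < gain η M a := by
  have := three_mul_sq_le_gain η M a
  have := one_le_natCast K
  nlinarith

theorem wt_total_le (hη : 0 ≤ η) (M n : Fin K → ℕ) (a : Fin K) :
    wt η (total η M n) a ≤ wt η M a := by
  refine Real.exp_le_exp.2 (neg_le_neg (mul_le_mul_of_nonneg_left ?_ hη))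
  exact_mod_cast Nat.le_add_right _ _

/-- The exponent has moved by less than 1 and e < 3; hence the factor 3 in `gain`. -/
theorem Fresh.le_wt_total {M n : Fin K → ℕ} (h : Fresh η M n) (a : Fin K) :
    wt η M a / 3 ≤ wt η (total η M n) a := by
  have h1 : wt η (total η M n) a = wt η M a * Real.exp (-(η * gain η M a * n a)) := by
    rw [wt, wt, ← Real.exp_add, total]
    push_cast
    congr 1
    ring
  have h2 : Real.exp (-1) ≤ Real.exp (-(η * gain η M a * n a)) :=
    Real.exp_le_exp.2 (by linarith [h a])
  have h3 : (1 : ℝ) / 3 ≤ Real.exp (-1) := by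
    rw [Real.exp_neg, ← one_div]
    exact one_div_le_one_div_of_le (Real.exp_pos 1) Real.exp_one_lt_three.le
  rw [h1]
  nlinarith [wt_pos η M a]

/-- If `b` is not the leader, the term of the leader is at most the weight of `b`, which replaces
the term missing at `b`. -/
theorem sum_min_le_rest (M : Fin K → ℕ) (b : Fin K) :
    ∑ c ∈ Finset.univ.erase b, min (wt η M c) (wt η M b) ≤ rest η M := by
  rw [rest, sum_wt_sub]
  by_cases h : b = lead η M
  · rw [← h]
    exact Finset.sum_le_sum fun c _ => min_le_left _ _
  · rw [← Finset.add_sum_erase _ _ (Finset.mem_erase.2 ⟨Ne.symm h, Finset.mem_univ (lead η M)⟩),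
      ← Finset.add_sum_erase _ (fun c => wt η M c) (Finset.mem_erase.2 ⟨h, Finset.mem_univ b⟩),
      Finset.erase_right_comm]
    exact add_le_add (min_le_right _ _) (Finset.sum_le_sum fun c _ => min_le_left _ _)

/-- This is what the tilt is for: each term of the mass is 2 w_b w_c / (w_b + w_c), at most twice
the smaller weight, so a heavy action cannot swamp Alice's normalization when Bob plays a light one.
-/
theorem mass_zero_le (M : Fin K → ℕ) {a b : Fin K} (h : a ≠ b) :
    mass η M (fun _ => 0) b ≤ tilt η M b a * (K * wt η M a + rest η M) := by
  have ha := wt_pos η M a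
  have hb := wt_pos η M b
  have h1 : ∑ c ∈ Finset.univ.erase b, (wt η M a + min (wt η M c) (wt η M b)) ≤
      K * wt η M a + rest η M := by
    rw [Finset.sum_add_distrib, Finset.sum_const, Finset.card_erase_of_mem (Finset.mem_univ b),
      Finset.card_univ, Fintype.card_fin, nsmul_eq_mul]
    have h2 : ((K - 1 : ℕ) : ℝ) ≤ K := by exact_mod_cast Nat.sub_le K 1
    have := mul_le_mul_of_nonneg_right h2 ha.le
    have := sum_min_le_rest η M b
    linarith
  refine le_trans ?_ (mul_le_mul_of_nonneg_left h1 (tilt_nonneg η M b a))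
  rw [mass, total_zero, ← Finset.add_sum_erase _ _ (Finset.mem_univ b), tilt_self, zero_mul,
    zero_add, Finset.mul_sum]
  refine Finset.sum_le_sum fun c hc => ?_
  rw [tilt, tilt, if_neg (Finset.ne_of_mem_erase hc), if_neg h]
  have hc := wt_pos η M c
  rw [div_mul_eq_mul_div, div_mul_eq_mul_div, div_le_div_iff₀ (by positivity) (by positivity)]
  have key : wt η M c * (wt η M a + wt η M b) ≤
      (wt η M a + min (wt η M c) (wt η M b)) * (wt η M c + wt η M b) := by
    rcases le_total (wt η M c) (wt η M b) with hcb | hcb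
    · rw [min_eq_left hcb]; nlinarith [mul_pos ha hb, mul_pos hc hc]
    · rw [min_eq_right hcb]; nlinarith [mul_pos ha hb, mul_pos hb hb]
  nlinarith

/-- Numerators lose at most a factor 3 while fresh and the normalization only decreases; `gain` is
the resulting lower bound inverted, times K, and rounded up. -/
theorem Fresh.div_gain_le_cond (hη : 0 ≤ η) (hK : 2 ≤ K) {M n : Fin K → ℕ} (hn : Fresh η M n)
    {a b : Fin K} (h : a ≠ b) : K / (gain η M a : ℝ) ≤ cond η M n b a := by
  have ha := wt_pos η M a
  have hr := rest_nonneg η M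
  have hK1 := one_le_natCast K
  have ht := tilt_pos η M h
  have h1 : mass η M n b ≤ tilt η M b a * (K * wt η M a + rest η M) := by
    refine le_trans ?_ (mass_zero_le η M h)
    refine Finset.sum_le_sum fun c _ => mul_le_mul_of_nonneg_left ?_ (tilt_nonneg η M b c)
    rw [total_zero]
    exact wt_total_le η hη M n c
  have h2 : K / (gain η M a : ℝ) ≤ wt η M a / (3 * (K * wt η M a + rest η M)) := by
    have e : wt η M a / (3 * (K * wt η M a + rest η M)) =
        K / (3 * K * (K + rest η M / wt η M a)) := by
      have : K * wt η M a + rest η M ≠ 0 := by positivity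
      field_simp
    rw [e]
    exact div_le_div_of_nonneg_left (by positivity) (by positivity) (le_gain η M a)
  refine h2.trans ?_
  rw [cond, div_le_div_iff₀ (by positivity) (mass_pos η hK M n b)]
  have h3 := Fresh.le_wt_total η hn a
  calc wt η M a * mass η M n b ≤ wt η M a * (tilt η M b a * (K * wt η M a + rest η M)) :=
        mul_le_mul_of_nonneg_left h1 ha.le
    _ = tilt η M b a * (wt η M a / 3) * (3 * (K * wt η M a + rest η M)) := by ring
    _ ≤ _ := by gcongr

/-- Only the pairs containing the leader are kept; 9 comes from two weights, each within a factor 3.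
-/
theorem Fresh.le_pairSum_total {M n : Fin K → ℕ} (hn : Fresh η M n) :
    2 * wt η M (lead η M) * rest η M ≤ 9 * pairSum η (total η M n) := by
  set u := wt η (total η M n)
  set i := lead η M
  have hu : ∀ a, wt η M a / 3 ≤ u a := Fresh.le_wt_total η hn
  have hu0 : ∀ a, 0 < u a := wt_pos η _
  have h1 : rest η M / 3 ≤ ∑ c, u c - u i := by
    rw [rest, sum_wt_sub, sum_wt_sub, Finset.sum_div]
    exact Finset.sum_le_sum fun c _ => hu c
  have h2 : u i * (∑ c, u c - u i) + (∑ c, u c - u i) * u i ≤ pairSum η (total η M n) := by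
    rw [pairSum_eq, ← Finset.add_sum_erase _ (fun b => u b * (∑ c, u c - u b)) (Finset.mem_univ i)]
    refine add_le_add (le_refl _) ?_
    conv_lhs => rw [sum_wt_sub, Finset.sum_mul]
    refine Finset.sum_le_sum fun c hc => mul_le_mul_of_nonneg_left ?_ (hu0 c).le
    exact wt_le_sum_sub η _ (Finset.ne_of_mem_erase hc).symm
  have h3 : wt η M i / 3 * (rest η M / 3) ≤ u i * (∑ c, u c - u i) :=
    mul_le_mul (hu i) h1 (div_nonneg (rest_nonneg η M) (by norm_num)) (hu0 i).le
  linarith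

/-- The partner's weight is at most K times the leader's, and this cancels against the lower bound
on `pairSum`. -/
theorem Fresh.incl_mul_rest_le (hη : 0 ≤ η) (hK : 2 ≤ K) {M n : Fin K → ℕ} (hn : Fresh η M n)
    (a : Fin K) : incl η (total η M n) a * (rest η M / wt η M a) ≤ 9 * K := by
  have ha := wt_pos η M a
  have hi := wt_pos η M (lead η M)
  have hr := rest_nonneg η M
  have hZ := pairSum_pos η hK (total η M n)
  have hu := wt_pos η (total η M n) a
  have h1 : ∑ c, wt η (total η M n) c - wt η (total η M n) a ≤ K * wt η M (lead η M) := by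
    have : ∑ c, wt η (total η M n) c ≤ ∑ _c : Fin K, wt η M (lead η M) :=
      Finset.sum_le_sum fun c _ => (wt_total_le η hη M n c).trans (wt_le_wt_lead η M c)
    simp at this
    linarith
  rw [incl, div_mul_div_comm, div_le_iff₀ (mul_pos hZ ha)]
  calc 2 * wt η (total η M n) a * (∑ c, wt η (total η M n) c - wt η (total η M n) a) * rest η M
      ≤ 2 * wt η M a * (K * wt η M (lead η M)) * rest η M := by
        have := wt_total_le η hη M n a
        have := sum_wt_sub_nonneg η (total η M n) a
        gcongr
    _ = K * wt η M a * (2 * wt η M (lead η M) * rest η M) := by ring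
    _ ≤ K * wt η M a * (9 * pairSum η (total η M n)) := by
        have := Fresh.le_pairSum_total η hn
        gcongr
    _ = _ := by ring

/-- The second-order term of the regret. As the inclusion probabilities sum to 2, the sum is at most
6K² + 2 + 27K³, and K ≥ 2 absorbs the lower terms. -/
theorem Fresh.sum_incl_mul_gain_le (hη : 0 ≤ η) (hK : 2 ≤ K) {M n : Fin K → ℕ}
    (hn : Fresh η M n) : ∑ a, incl η (total η M n) a * gain η M a ≤ 31 * (K : ℝ) ^ 3 := by
  have hK2 : (2 : ℝ) ≤ K := by exact_mod_cast hK
  have h1 : ∀ a, incl η (total η M n) a * gain η M a ≤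
      incl η (total η M n) a * (3 * K ^ 2 + 1) + 27 * K ^ 2 := by
    intro a
    have h2 := mul_le_mul_of_nonneg_left (gain_le η M a) (incl_nonneg η hK (total η M n) a)
    have h3 := mul_le_mul_of_nonneg_left (Fresh.incl_mul_rest_le η hη hK hn a)
      (by positivity : (0 : ℝ) ≤ 3 * K)
    linarith
  refine (Finset.sum_le_sum fun a _ => h1 a).trans ?_
  rw [Finset.sum_add_distrib, ← Finset.sum_mul, sum_incl η hK]
  simp
  nlinarith [mul_nonneg (sub_nonneg.2 hK2) (sq_nonneg (K : ℝ)), sq_nonneg (K : ℝ)]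

end Bounds

/-! ### The joint state and its one-round dynamics -/

/-- The joint state of the game: the loss estimates `base` at the last communication step, the
numbers `hits` of losses observed since then, Bob's action, and whether a player wants to
communicate. -/
@[ext]
structure State (K : ℕ) where
  base : Fin K → ℕ
  hits : Fin K → ℕ
  pos : Fin K
  alarm : Bool

instance (K : ℕ) : MeasurableSpace (State K) := ⊤

instance (K : ℕ) : DiscreteMeasurableSpace (State K) := ⟨fun _ => trivial⟩

/-- Rounding `gain` to an integer makes the states countable, so every function of the state is
measurable. -/
instance (K : ℕ) : Countable (State K) :=
  Function.Injective.countable (f := fun s : State K => (s.base, s.hits, s.pos, s.alarm))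
    fun s s' h => by
      simp only [Prod.mk.injEq] at h
      exact State.ext h.1 h.2.1 h.2.2.1 h.2.2.2

theorem integrable_of_finite_range {α S : Type*} [MeasurableSpace α] [MeasurableSpace S]
    [DiscreteMeasurableSpace S] {ν : Measure α} [IsFiniteMeasure ν] {g : α → S}
    (hg : Measurable g) (hfin : (Set.range g).Finite) (f : S → ℝ) :
    Integrable (fun x => f (g x)) ν := by
  obtain ⟨C, hC⟩ := (hfin.image fun s => ‖f s‖).bddAbove
  exact Integrable.of_bound (Measurable.of_discrete.comp hg).aestronglyMeasurable C
    (Filter.Eventually.of_forall fun x => hC ⟨g x, ⟨x, rfl⟩, rfl⟩)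

section Dynamics

variable {K : ℕ} [NeZero K] (η : ℝ)

/-- The uniform distribution. -/
noncomputable def unif (K : ℕ) : Fin K → ℝ := fun _ => 1 / K

theorem isProb_unif : IsProb (unif K) := by
  refine ⟨fun a => by unfold unif; positivity, ?_⟩
  have : (K : ℝ) ≠ 0 := NeZero.ne _
  simp [unif, this]

/-- The state after a communication step in which the loss estimates turn out to be `L`. -/
noncomputable def draw (L : Fin K → ℕ) (u : unitInterval) : State K :=
  ⟨L, fun _ => 0, pick (marg η L fun _ => 0) u, false⟩

/-- The state after the communication phase of a round. -/
noncomputable def settle (s : State K) (u : unitInterval) : State K :=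
  if s.alarm then draw η (total η s.base s.hits) u else s

/-- The probability that a loss `y` of `e` is recorded, when `e` is the public action of the round
and is played. -/
noncomputable def chance (s : State K) (e : Fin K) (y : ℝ) : ℝ :=
  if e = s.pos then y * K / gain η s.base e
  else y * K / (gain η s.base e * cond η s.base s.hits s.pos e)

open Classical in
/-- The state after the loss `y` of the public action `e` may have been recorded; `mine` tells
whether it has been observed. -/
noncomputable def record (s : State K) (mine : Bool) (e : Fin K) (y : ℝ) (u : unitInterval) :
    State K :=
  if mine = true ∧ (u : ℝ) < chance η s e y then
    if (u : ℝ) < chance η s e y * (1 - surv η s.base s.hits s.pos e) ∨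
        1 ≤ η * gain η s.base e * (s.hits e + 1) then
      ⟨s.base, hit s.hits e, s.pos, true⟩
    else ⟨s.base, hit s.hits e, s.pos, false⟩
  else ⟨s.base, s.hits, s.pos, false⟩

/-- Alice's action. -/
noncomputable def aliceMove (s : State K) (u : unitInterval) : Fin K :=
  pick (cond η s.base s.hits s.pos) u

/-- The state after the players have acted. -/
noncomputable def play (l : Fin K → ℝ) (s : State K)
    (ω : unitInterval × unitInterval × unitInterval) : State K :=
  record η s (decide (pick (unif K) ω.1 = s.pos ∨ aliceMove η s ω.2.1 = pick (unif K) ω.1))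
    (pick (unif K) ω.1) (l (pick (unif K) ω.1)) ω.2.2

/-- Four independent uniform variables extracted from one. -/
noncomputable def split : unitInterval →
    unitInterval × unitInterval × unitInterval × unitInterval := exists_split.choose

theorem measurable_split : Measurable split := exists_split.choose_spec.1

theorem map_split : (volume : Measure unitInterval).map split = volume :=
  exists_split.choose_spec.2

/-- One round. -/
noncomputable def step (ℓ : ℕ → Fin K → ℝ) (t : ℕ) (s : State K) (r : unitInterval) : State K :=
  play η (ℓ t) (settle η s (split r).1) (split r).2

theorem measurable_record :
    Measurable fun p : (State K × Bool × Fin K) × ℝ × unitInterval =>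
      record η p.1.1 p.1.2.1 p.1.2.2 p.2.1 p.2.2 := by
  refine measurable_from_prod_countable_right fun q => ?_
  have hc : Measurable fun p : ℝ × unitInterval => chance η q.1 q.2.2 p.1 := by
    unfold chance
    split_ifs <;> fun_prop
  have hu : Measurable fun p : ℝ × unitInterval => (p.2 : ℝ) :=
    measurable_subtype_coe.comp measurable_snd
  change Measurable fun p : ℝ × unitInterval => record η q.1 q.2.1 q.2.2 p.1 p.2
  unfold record
  refine Measurable.ite ?_ (Measurable.ite ?_ measurable_const measurable_const) measurable_const
  · exact (MeasurableSet.const _).inter (measurableSet_lt hu hc)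
  · exact (measurableSet_lt hu (hc.mul_const _)).union (MeasurableSet.const _)

theorem measurable_settle : Measurable fun p : State K × unitInterval => settle η p.1 p.2 := by
  refine measurable_from_prod_countable_right fun s => ?_
  simp only [settle]
  split_ifs
  · exact (Measurable.of_discrete (f := fun b : Fin K =>
      (⟨total η s.base s.hits, fun _ => 0, b, false⟩ : State K))).comp (measurable_pick _)
  · exact measurable_const

theorem measurable_aliceMove :
    Measurable fun p : State K × unitInterval => aliceMove η p.1 p.2 :=
  measurable_from_prod_countable_right fun s =>
    measurable_pick (cond η s.base s.hits s.pos)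

theorem measurable_play (l : Fin K → ℝ) : Measurable fun p : State K ×
    unitInterval × unitInterval × unitInterval => play η l p.1 p.2 := by
  have he : Measurable fun p : State K × unitInterval × unitInterval × unitInterval =>
      pick (unif K) p.2.1 := (measurable_pick (unif K)).comp measurable_snd.fst
  have ha : Measurable fun p : State K × unitInterval × unitInterval × unitInterval =>
      aliceMove η p.1 p.2.2.1 :=
    (measurable_aliceMove η).comp (measurable_fst.prodMk measurable_snd.snd.fst)
  have hd : Measurable fun q : State K × Fin K × Fin K =>
      ((q.1, decide (q.2.1 = q.1.pos ∨ q.2.2 = q.2.1), q.2.1) : State K × Bool × Fin K) :=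
    Measurable.of_discrete
  have hq := hd.comp (measurable_fst.prodMk (he.prodMk ha))
  have hl : Measurable fun p : State K × unitInterval × unitInterval × unitInterval =>
      l (pick (unif K) p.2.1) := (Measurable.of_discrete (f := l)).comp he
  exact (measurable_record η).comp (hq.prodMk (hl.prodMk measurable_snd.snd.snd))

theorem measurable_step (ℓ : ℕ → Fin K → ℝ) (t : ℕ) (s : State K) :
    Measurable (step η ℓ t s) := by
  have h1 : Measurable fun r => settle η s (split r).1 :=
    (measurable_settle η).comp (measurable_const.prodMk (measurable_split.fst))
  exact (measurable_play η (ℓ t)).comp (h1.prodMk measurable_split.snd)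

theorem record_mem (s : State K) (mine : Bool) (e : Fin K) (y : ℝ) (u : unitInterval) :
    record η s mine e y u ∈
      insert (⟨s.base, s.hits, s.pos, false⟩ : State K)
        (Set.range fun q : Fin K × Bool => ⟨s.base, hit s.hits q.1, s.pos, q.2⟩) := by
  unfold record
  split_ifs
  · exact Or.inr ⟨(e, true), rfl⟩
  · exact Or.inr ⟨(e, false), rfl⟩
  · exact Or.inl rfl

theorem finite_range_play (l : Fin K → ℝ) (s : State K) : (Set.range (play η l s)).Finite :=
  ((Set.finite_range _).insert _).subset (by rintro _ ⟨ω, rfl⟩; exact record_mem η s _ _ _ _)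

theorem finite_range_settle (s : State K) : (Set.range (settle η s)).Finite := by
  refine ((Set.finite_range fun b : Fin K =>
    (⟨total η s.base s.hits, fun _ => 0, b, false⟩ : State K)).insert s).subset ?_
  rintro _ ⟨u, rfl⟩
  rw [settle]
  split_ifs
  · exact Or.inr ⟨_, rfl⟩
  · exact Or.inl rfl

theorem finite_range_step (ℓ : ℕ → Fin K → ℝ) (t : ℕ) (s : State K) :
    (Set.range (step η ℓ t s)).Finite := by
  refine ((finite_range_settle η s).biUnion fun s' _ => finite_range_play η (ℓ t) s').subset ?_
  rintro _ ⟨r, rfl⟩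
  exact Set.mem_biUnion ⟨_, rfl⟩ ⟨_, rfl⟩

/-- An alarm is raised when some loss estimate has changed substantially. -/
def Good (s : State K) : Prop := s.alarm = true ∨ Fresh η s.base s.hits

variable {η}

theorem Good.settle {s : State K} (hs : Good η s) (u : unitInterval) :
    (settle η s u).alarm = false ∧ Fresh η (settle η s u).base (settle η s u).hits := by
  rw [CommBandit.settle]
  split_ifs with h
  · exact ⟨rfl, fresh_zero η _⟩
  · exact ⟨by simpa using h, hs.resolve_left h⟩

theorem Good.record {s : State K} (hs : Fresh η s.base s.hits) (mine : Bool) (e : Fin K) (y : ℝ)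
    (u : unitInterval) : Good η (record η s mine e y u) := by
  unfold CommBandit.record
  split_ifs with h1 h2
  · exact Or.inl rfl
  · right
    intro a
    by_cases ha : a = e
    · subst ha
      push Not at h2
      simpa [hit] using h2.2
    · simpa [hit, ha] using hs a
  · exact Or.inr hs

theorem Good.step {s : State K} (hs : Good η s) (ℓ : ℕ → Fin K → ℝ) (t : ℕ) (r : unitInterval) :
    Good η (step η ℓ t s r) :=
  Good.record (hs.settle _).2 _ _ _ _

theorem Good.run {s₀ : State K} (hs : Good η s₀) (ℓ : ℕ → Fin K → ℝ) (R : ℕ → unitInterval)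
    (t : ℕ) : Good η (run (CommBandit.step η ℓ) s₀ R t) := by
  induction t with
  | zero => exact hs
  | succ t ih => exact ih.step ℓ t (R t)

variable (η)

/-- The mean of `f` over the state reached from the settled state `(M, n, b)`. -/
noncomputable def kern (l : Fin K → ℝ) (f : State K → ℝ) (M n : Fin K → ℕ) (b : Fin K) : ℝ :=
  ∑ e, l e / gain η M e *
      (surv η M n b e * f ⟨M, hit n e, b, decide (1 ≤ η * gain η M e * (n e + 1))⟩ +
        (1 - surv η M n b e) * f ⟨M, hit n e, b, true⟩) +
    (1 - ∑ e, l e / gain η M e) * f ⟨M, n, b, false⟩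

/-- The mean of `G` over the settled state reached from `s`. -/
noncomputable def settled (G : (Fin K → ℕ) → (Fin K → ℕ) → Fin K → ℝ) (s : State K) : ℝ :=
  if s.alarm then ∑ b, marg η (total η s.base s.hits) (fun _ => 0) b *
    G (total η s.base s.hits) (fun _ => 0) b
  else G s.base s.hits s.pos

/-- The thinning compensates for the probability that `e` is played. The result does not depend on
Bob's action, so recording alone reveals nothing about it. -/
theorem chance_mul (hK : 2 ≤ K) {s : State K} (e : Fin K) (y : ℝ) :
    (if e = s.pos then 1 else cond η s.base s.hits s.pos e) * chance η s e y =
      y * K / gain η s.base e := by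
  rw [chance]
  split_ifs with h
  · rw [one_mul]
  · have := (cond_pos η hK s.base s.hits h).ne'
    have := (gain_pos η s.base e).ne'
    field_simp

/-- The thinning is a genuine probability: `gain` is at least K for Bob, and
`Fresh.div_gain_le_cond` serves for Alice. -/
theorem chance_mem (hη : 0 ≤ η) (hK : 2 ≤ K) {s : State K} (hs : Fresh η s.base s.hits)
    (e : Fin K) {y : ℝ} (hy : y ∈ Set.Icc (0 : ℝ) 1) :
    0 ≤ chance η s e y ∧ chance η s e y ≤ 1 := by
  have hg := gain_pos η s.base e
  have hK0 : (0 : ℝ) ≤ K := Nat.cast_nonneg K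
  have hK1 := one_le_natCast K
  have hg3 := three_mul_sq_le_gain η s.base e
  rw [chance]
  split_ifs with h
  · refine ⟨div_nonneg (mul_nonneg hy.1 hK0) hg.le, div_le_one_of_le₀ ?_ hg.le⟩
    nlinarith [hy.1, hy.2]
  · have hc := cond_pos η hK s.base s.hits h
    refine ⟨div_nonneg (mul_nonneg hy.1 hK0) (mul_pos hg hc).le,
      div_le_one_of_le₀ ?_ (mul_pos hg hc).le⟩
    have := Fresh.div_gain_le_cond η hη hK hs h
    rw [div_le_iff₀ hg] at this
    nlinarith [hy.1, hy.2]

theorem integral_record (hη : 0 ≤ η) (hK : 2 ≤ K) {s : State K} (hs : Fresh η s.base s.hits)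
    (mine : Bool) (e : Fin K) {y : ℝ} (hy : y ∈ Set.Icc (0 : ℝ) 1) (f : State K → ℝ) :
    ∫ u, f (record η s mine e y u) = f ⟨s.base, s.hits, s.pos, false⟩ +
      (if mine then chance η s e y else 0) *
        (surv η s.base s.hits s.pos e *
            f ⟨s.base, hit s.hits e, s.pos, decide (1 ≤ η * gain η s.base e * (s.hits e + 1))⟩ +
          (1 - surv η s.base s.hits s.pos e) * f ⟨s.base, hit s.hits e, s.pos, true⟩ -
          f ⟨s.base, s.hits, s.pos, false⟩) := by
  obtain ⟨hc0, hc1⟩ := chance_mem η hη hK hs e hy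
  have hs0 := surv_nonneg η hK s.base s.hits s.pos e
  have hs1 := surv_le_one η hη hK s.base s.hits s.pos e
  cases mine with
  | false => simp [record]
  | true =>
    have h : (fun u => f (record η s true e y u)) = fun u : unitInterval =>
        if (u : ℝ) < chance η s e y then
          (if (u : ℝ) < chance η s e y * (1 - surv η s.base s.hits s.pos e) then
            f ⟨s.base, hit s.hits e, s.pos, true⟩ else
            f ⟨s.base, hit s.hits e, s.pos, decide (1 ≤ η * gain η s.base e * (s.hits e + 1))⟩)
        else f ⟨s.base, s.hits, s.pos, false⟩ := by
      funext u
      unfold record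
      by_cases h1 : (u : ℝ) < chance η s e y
      · by_cases h2 : (u : ℝ) < chance η s e y * (1 - surv η s.base s.hits s.pos e)
        · simp [h1, h2]
        · by_cases h3 : 1 ≤ η * gain η s.base e * (s.hits e + 1) <;> simp [h1, h2, h3]
      · simp [h1]
    rw [h, integral_nested_ite_lt (mul_nonneg hc0 (by linarith)) (by nlinarith) hc1, if_pos rfl]
    ring

/-- The probability 1/K of a public action cancels the K in `chance`, leaving the recording
probability l_e / gain_e of `kern`. -/
theorem integral_play (hη : 0 ≤ η) (hK : 2 ≤ K) {l : Fin K → ℝ}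
    (hl : ∀ a, l a ∈ Set.Icc (0 : ℝ) 1) {M n : Fin K → ℕ} (hn : Fresh η M n) (b : Fin K)
    (f : State K → ℝ) : ∫ ω, f (play η l ⟨M, n, b, false⟩ ω) = kern η l f M n b := by
  set s : State K := ⟨M, n, b, false⟩
  have hrec : ∀ (mine : Bool) (e : Fin K), Integrable
      (fun u : unitInterval => f (record η s mine e (l e) u)) := fun mine e =>
    integrable_of_finite_range (g := fun u => record η s mine e (l e) u)
      ((measurable_record η).comp ((measurable_const (a := (s, mine, e))).prodMk
        ((measurable_const (a := l e)).prodMk measurable_id)))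
      (((Set.finite_range _).insert _).subset (by
        rintro _ ⟨u, rfl⟩
        exact record_mem η s mine e (l e) u)) f
  have hrec2 : ∀ e : Fin K, Integrable (fun z : unitInterval × unitInterval =>
      f (record η s (decide (e = b ∨ aliceMove η s z.1 = e)) e (l e) z.2)) := fun e => by
    have hm : Measurable fun z : unitInterval × unitInterval =>
        ((s, decide (e = b ∨ aliceMove η s z.1 = e), e) : State K × Bool × Fin K) :=
      (Measurable.of_discrete (f := fun a : Fin K =>
        ((s, decide (e = b ∨ a = e), e) : State K × Bool × Fin K))).comp
        ((measurable_pick _).comp measurable_fst)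
    exact integrable_of_finite_range (g := fun z : unitInterval × unitInterval =>
        record η s (decide (e = b ∨ aliceMove η s z.1 = e)) e (l e) z.2)
      ((measurable_record η).comp (hm.prodMk ((measurable_const (a := l e)).prodMk measurable_snd)))
      (((Set.finite_range _).insert _).subset (by
        rintro _ ⟨z, rfl⟩
        exact record_mem η s _ e (l e) z.2)) f
  set f₀ := f ⟨M, n, b, false⟩
  set A : Fin K → ℝ := fun e =>
    surv η M n b e * f ⟨M, hit n e, b, decide (1 ≤ η * gain η M e * (n e + 1))⟩ +
      (1 - surv η M n b e) * f ⟨M, hit n e, b, true⟩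
  have h1 : ∀ e : Fin K, ∫ z : unitInterval × unitInterval,
      f (record η s (decide (e = b ∨ aliceMove η s z.1 = e)) e (l e) z.2) =
        f₀ + l e * K / gain η M e * (A e - f₀) := by
    intro e
    have h := (isProb_cond η hK M n b).integral_pick_prod (ν := (volume : Measure unitInterval))
      (H := fun a u => f (record η s (decide (e = b ∨ a = e)) e (l e) u)) fun a => hrec _ _
    refine h.trans ?_
    simp only [integral_record η hη hK (s := s) hn _ e (hl e) f]
    change ∑ a, cond η M n b a * (f₀ + _ * (A e - f₀)) = _
    have hsum : ∑ a, cond η M n b a * (if decide (e = b ∨ a = e) = true then chance η s e (l e)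
        else 0) = l e * K / gain η M e := by
      rw [← chance_mul η hK (s := s) e (l e)]
      by_cases he : e = b
      · simp only [he, true_or, decide_true, if_true]
        rw [← Finset.sum_mul, (isProb_cond η hK M n b).2]
        simp [s]
      · simp [he, s]
    simp only [mul_add, Finset.sum_add_distrib, ← Finset.sum_mul, ← mul_assoc]
    rw [hsum, (isProb_cond η hK M n b).2, one_mul]
  have h := (isProb_unif (K := K)).integral_pick_prod
    (ν := (volume : Measure (unitInterval × unitInterval)))
    (H := fun e z => f (record η s (decide (e = b ∨ aliceMove η s z.1 = e)) e (l e) z.2)) hrec2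
  refine h.trans ?_
  have hK0 : (K : ℝ) ≠ 0 := NeZero.ne _
  have h2 : ∀ e, unif K e * (f₀ + l e * K / gain η M e * (A e - f₀)) =
      1 / K * f₀ + (l e / gain η M e * A e - l e / gain η M e * f₀) := by
    intro e
    rw [unif]
    field_simp
  simp only [h1, h2]
  change _ = ∑ e, l e / gain η M e * A e + (1 - ∑ e, l e / gain η M e) * f₀
  rw [Finset.sum_add_distrib, Finset.sum_sub_distrib,
    ← Finset.sum_mul Finset.univ (fun e => l e / gain η M e) f₀]
  simp only [Finset.sum_const, Finset.card_univ, Fintype.card_fin, nsmul_eq_mul]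
  rw [← mul_assoc, mul_one_div_cancel hK0]
  ring

theorem integral_settle (hK : 2 ≤ K) (s : State K)
    {H : State K → unitInterval × unitInterval × unitInterval → ℝ}
    (hH : ∀ s, Integrable (H s)) (hm : Measurable (Function.uncurry H)) :
    ∫ r, H (settle η s (split r).1) (split r).2 =
      settled η (fun M n b => ∫ ω, H ⟨M, n, b, false⟩ ω) s := by
  have hmap : ∫ r, H (settle η s (split r).1) (split r).2 =
      ∫ z : unitInterval × unitInterval × unitInterval × unitInterval,
        H (settle η s z.1) z.2 := by
    have hm' : Measurable fun z : unitInterval × unitInterval × unitInterval × unitInterval =>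
        H (settle η s z.1) z.2 := hm.comp
      (((measurable_settle η).comp (measurable_const.prodMk measurable_fst)).prodMk measurable_snd)
    rw [← map_split, integral_map measurable_split.aemeasurable hm'.aestronglyMeasurable]
  rw [hmap]
  cases ha : s.alarm with
  | true =>
    simp only [settle, settled, ha, if_true, draw]
    exact (isProb_marg η hK (total η s.base s.hits) fun _ => 0).integral_pick_prod
      (H := fun b => H ⟨total η s.base s.hits, fun _ => 0, b, false⟩) fun b => hH _
  | false =>
    have hs : s = ⟨s.base, s.hits, s.pos, false⟩ := by rw [← ha]
    simp only [settle, settled, ha, Bool.false_eq_true, if_false]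
    rw [Measure.volume_eq_prod, integral_fun_snd]
    simp
    rw [← hs]

end Dynamics

/-! ### Regret and communication of the joint process -/

section Analysis

variable {K : ℕ} [NeZero K] (η : ℝ)

theorem integral_step (hη : 0 ≤ η) (hK : 2 ≤ K) {ℓ : ℕ → Fin K → ℝ}
    (hl : ∀ t a, ℓ t a ∈ Set.Icc (0 : ℝ) 1) (t : ℕ) {s : State K} (hs : Good η s)
    (f : State K → ℝ) : ∫ r, f (step η ℓ t s r) = settled η (kern η (ℓ t) f) s := by
  have h := integral_settle η hK s (H := fun s ω => f (play η (ℓ t) s ω))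
    (fun s => integrable_of_finite_range
      ((measurable_play η (ℓ t)).comp (measurable_const.prodMk measurable_id))
      (finite_range_play η (ℓ t) s) f)
    (Measurable.of_discrete.comp (measurable_play η (ℓ t)))
  refine h.trans ?_
  rcases hs' : s.alarm with _ | _
  · simp only [settled, hs', Bool.false_eq_true, if_false]
    exact integral_play η hη hK (hl t) (hs.resolve_left (by simp [hs'])) _ f
  · simp only [settled, hs', if_true]
    exact Finset.sum_congr rfl fun b _ => by
      rw [integral_play η hη hK (hl t) (fresh_zero η _) b f]

/-- The state before the first round. -/
def start (K : ℕ) [NeZero K] : State K := ⟨fun _ => 0, fun _ => 0, 0, true⟩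

/-- The state before round `t`. -/
noncomputable def traj (ℓ : ℕ → Fin K → ℝ) (R : ℕ → unitInterval) (t : ℕ) : State K :=
  run (step η ℓ) (start K) R t

theorem good_traj (ℓ : ℕ → Fin K → ℝ) (R : ℕ → unitInterval) (t : ℕ) : Good η (traj η ℓ R t) :=
  Good.run (Or.inl rfl) ℓ R t

instance : IsProbabilityMeasure sharedLaw := by
  unfold sharedLaw
  infer_instance

theorem integrable_traj (ℓ : ℕ → Fin K → ℝ) (t : ℕ) (f : State K → ℝ) :
    Integrable (fun R => f (traj η ℓ R t)) sharedLaw :=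
  integrable_of_finite_range (measurable_run (measurable_step η ℓ) t)
    (finite_range_run (finite_range_step η ℓ) t) f

theorem integral_traj_succ (hη : 0 ≤ η) (hK : 2 ≤ K) {ℓ : ℕ → Fin K → ℝ}
    (hl : ∀ t a, ℓ t a ∈ Set.Icc (0 : ℝ) 1) (t : ℕ) (f : State K → ℝ) :
    ∫ R, f (traj η ℓ R (t + 1)) ∂sharedLaw =
      ∫ R, settled η (kern η (ℓ t) f) (traj η ℓ R t) ∂sharedLaw := by
  have h := (integrable_run_prod (s₀ := start K) (ν := (volume : Measure unitInterval))
    (measurable_step η ℓ) (finite_range_step η ℓ) t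
    (F := fun s r => f (step η ℓ t s r)) fun s =>
      integrable_of_finite_range (measurable_step η ℓ t s) (finite_range_step η ℓ t s) f).2
  refine h.trans (integral_congr_ae (Filter.Eventually.of_forall fun R => ?_))
  exact integral_step η hη hK hl t (good_traj η ℓ R t) f

/-- The average over the law of Bob's action, unless Bob's action is about to be replaced. -/
noncomputable def avg (f : State K → ℝ) (s : State K) : ℝ :=
  if s.alarm then f s else ∑ b, marg η s.base s.hits b * f ⟨s.base, s.hits, b, false⟩

/-- By `marg_mul_surv` the averaged silent transitions carry the updated law of Bob's action. The
threshold alarm does not bias it, as it is decided without looking at Bob's action. -/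
theorem sum_marg_kern (hK : 2 ≤ K) (f : State K → ℝ) (l : Fin K → ℝ) (M n : Fin K → ℕ) :
    ∑ b, marg η M n b * kern η l f M n b =
      ∑ b, marg η M n b * kern η l (avg η f) M n b := by
  have hone : ∀ n, ∑ b, marg η M n b = 1 := fun n => (isProb_marg η hK M n).2
  have h0 : ∑ b, marg η M n b * f ⟨M, n, b, false⟩ =
      ∑ b, marg η M n b * avg η f ⟨M, n, b, false⟩ := by
    simp only [avg, Bool.false_eq_true, if_false]
    rw [← Finset.sum_mul, hone, one_mul]
  have h1 : ∀ n b, avg η f ⟨M, n, b, true⟩ = f ⟨M, n, b, true⟩ := fun n b => by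
    simp [avg]
  have h2 : ∀ e (d : Bool), ∑ b, marg η M n b * surv η M n b e * f ⟨M, hit n e, b, d⟩ =
      ∑ b, marg η M n b * surv η M n b e * avg η f ⟨M, hit n e, b, d⟩ := by
    intro e d
    cases d with
    | true => simp only [h1]
    | false =>
      simp only [avg, Bool.false_eq_true, if_false, marg_mul_surv η hK]
      rw [← Finset.sum_mul, ← Finset.sum_mul, hone, one_mul, mul_comm, Finset.sum_mul]
      refine Finset.sum_congr rfl fun b _ => ?_
      ring
  have expand : ∀ g : State K → ℝ, ∑ b, marg η M n b * kern η l g M n b =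
      ∑ e, l e / gain η M e *
        (∑ b, marg η M n b * surv η M n b e *
            g ⟨M, hit n e, b, decide (1 ≤ η * gain η M e * (n e + 1))⟩ +
          ∑ b, marg η M n b * (1 - surv η M n b e) * g ⟨M, hit n e, b, true⟩) +
      (1 - ∑ e, l e / gain η M e) * ∑ b, marg η M n b * g ⟨M, n, b, false⟩ := by
    intro g
    simp only [kern, mul_add, Finset.sum_add_distrib, Finset.mul_sum]
    congr 1
    · rw [Finset.sum_comm, Finset.sum_comm (f := fun b e => marg η M n b * (l e / gain η M e *
        ((1 - surv η M n b e) * g ⟨M, hit n e, b, true⟩)))]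
      congr 1 <;> exact Finset.sum_congr rfl fun e _ => Finset.sum_congr rfl fun b _ => by ring
    · exact Finset.sum_congr rfl fun b _ => by ring
  rw [expand, expand, h0]
  simp only [h2, h1]

/-- The mean of `G` over the settled state reached from `s`, averaged over Bob's action. -/
noncomputable def mean (G : (Fin K → ℕ) → (Fin K → ℕ) → Fin K → ℝ) (s : State K) : ℝ :=
  if s.alarm then ∑ b, marg η (total η s.base s.hits) (fun _ => 0) b *
    G (total η s.base s.hits) (fun _ => 0) b
  else ∑ b, marg η s.base s.hits b * G s.base s.hits b

theorem avg_settled (G : (Fin K → ℕ) → (Fin K → ℕ) → Fin K → ℝ) (s : State K) :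
    avg η (settled η G) s = mean η G s := by
  rcases hs : s.alarm with _ | _ <;> simp [avg, settled, mean, hs]

/-- Given the rest of a state without alarm, Bob's action has law `marg`. The initial alarm makes
the base case trivial. -/
theorem integral_traj_eq (hη : 0 ≤ η) (hK : 2 ≤ K) {ℓ : ℕ → Fin K → ℝ}
    (hl : ∀ t a, ℓ t a ∈ Set.Icc (0 : ℝ) 1) (t : ℕ) (f : State K → ℝ) :
    ∫ R, f (traj η ℓ R t) ∂sharedLaw = ∫ R, avg η f (traj η ℓ R t) ∂sharedLaw := by
  induction t generalizing f with
  | zero => rfl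
  | succ t ih =>
    rw [integral_traj_succ η hη hK hl, integral_traj_succ η hη hK hl, ih (settled η _),
      ih (settled η _)]
    refine integral_congr_ae (Filter.Eventually.of_forall fun R => ?_)
    simp only [avg_settled, mean]
    split_ifs
    · exact sum_marg_kern η hK f _ _ _
    · exact sum_marg_kern η hK f _ _ _

/-- The conditional expectation of the sum of the losses of the two players. -/
noncomputable def pairLoss (l : Fin K → ℝ) (M n : Fin K → ℕ) (b : Fin K) : ℝ :=
  l b + ∑ a, cond η M n b a * l a

theorem mean_pairLoss (hK : 2 ≤ K) (l : Fin K → ℝ) (s : State K) :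
    mean η (pairLoss η l) s = ∑ a, incl η (total η s.base s.hits) a * l a := by
  unfold mean pairLoss
  split_ifs
  · rw [sum_marg_mul η hK, total_zero]
  · rw [sum_marg_mul η hK]

theorem integral_pairLoss (hη : 0 ≤ η) (hK : 2 ≤ K) {ℓ : ℕ → Fin K → ℝ}
    (hl : ∀ t a, ℓ t a ∈ Set.Icc (0 : ℝ) 1) (t : ℕ) :
    Integrable (fun R : ℕ → unitInterval => ℓ t (settle η (traj η ℓ R t) (split (R t)).1).pos +
      ℓ t (aliceMove η (settle η (traj η ℓ R t) (split (R t)).1) (split (R t)).2.2.1)) sharedLaw ∧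
    ∫ R : ℕ → unitInterval, (ℓ t (settle η (traj η ℓ R t) (split (R t)).1).pos +
      ℓ t (aliceMove η (settle η (traj η ℓ R t) (split (R t)).1) (split (R t)).2.2.1)) ∂sharedLaw =
      ∫ R, ∑ a, incl η (total η (traj η ℓ R t).base (traj η ℓ R t).hits) a * ℓ t a ∂sharedLaw := by
  have hmH : Measurable (Function.uncurry fun (s : State K)
      (ω : unitInterval × unitInterval × unitInterval) =>
        ℓ t s.pos + ℓ t (aliceMove η s ω.2.1)) := by
    have h1 : Measurable fun p : State K × unitInterval × unitInterval × unitInterval =>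
        ℓ t p.1.pos := (Measurable.of_discrete (f := fun s : State K => ℓ t s.pos)).comp measurable_fst
    have h2 : Measurable fun p : State K × unitInterval × unitInterval × unitInterval =>
        ℓ t (aliceMove η p.1 p.2.2.1) := (Measurable.of_discrete (f := ℓ t)).comp
      ((measurable_aliceMove η).comp (measurable_fst.prodMk measurable_snd.snd.fst))
    exact h1.add h2
  have hb : ∀ a c, ‖ℓ t a + ℓ t c‖ ≤ 2 := fun a c => by
    rw [Real.norm_eq_abs, abs_le]
    constructor <;> linarith [(hl t a).1, (hl t a).2, (hl t c).1, (hl t c).2]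
  have hF : ∀ s : State K, Integrable fun r => ℓ t (settle η s (split r).1).pos +
      ℓ t (aliceMove η (settle η s (split r).1) (split r).2.2.1) := fun s =>
    Integrable.of_bound (hmH.comp (((measurable_settle η).comp
      (measurable_const.prodMk measurable_split.fst)).prodMk
        measurable_split.snd)).aestronglyMeasurable 2 (Filter.Eventually.of_forall fun r => hb _ _)
  have h := integrable_run_prod (s₀ := start K) (ν := (volume : Measure unitInterval))
    (measurable_step η ℓ) (finite_range_step η ℓ) t hF
  refine ⟨h.1, h.2.trans ?_⟩
  have hset : ∀ s : State K, ∫ r, (ℓ t (settle η s (split r).1).pos +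
      ℓ t (aliceMove η (settle η s (split r).1) (split r).2.2.1)) =
        settled η (pairLoss η (ℓ t)) s := by
    intro s
    have hH : ∀ s : State K, Integrable fun ω : unitInterval × unitInterval × unitInterval =>
        ℓ t s.pos + ℓ t (aliceMove η s ω.2.1) := fun s =>
      Integrable.of_bound (hmH.comp (measurable_const.prodMk measurable_id)).aestronglyMeasurable 2
        (Filter.Eventually.of_forall fun r => hb _ _)
    have hE : ∀ s : State K, ∫ ω : unitInterval × unitInterval × unitInterval,
        (ℓ t s.pos + ℓ t (aliceMove η s ω.2.1)) = pairLoss η (ℓ t) s.base s.hits s.pos := by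
      intro s
      have h2 : ∫ ω : unitInterval × unitInterval × unitInterval,
          (ℓ t s.pos + ℓ t (aliceMove η s ω.2.1)) =
          ∫ y : unitInterval × unitInterval, (ℓ t s.pos + ℓ t (aliceMove η s y.1)) := by
        rw [Measure.volume_eq_prod, integral_fun_snd
          (fun y : unitInterval × unitInterval => ℓ t s.pos + ℓ t (aliceMove η s y.1))]
        simp
      have h3 : ∫ y : unitInterval × unitInterval, (ℓ t s.pos + ℓ t (aliceMove η s y.1)) =
          ∫ u : unitInterval, (ℓ t s.pos + ℓ t (aliceMove η s u)) := by
        rw [Measure.volume_eq_prod, integral_fun_fst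
          (fun y : unitInterval => ℓ t s.pos + ℓ t (aliceMove η s y))]
        simp
      have hc := isProb_cond η hK s.base s.hits s.pos
      rw [h2, h3]
      refine (hc.integral_pick fun a => ℓ t s.pos + ℓ t a).trans ?_
      simp only [mul_add, Finset.sum_add_distrib, ← Finset.sum_mul, hc.2, one_mul, pairLoss]
    rw [integral_settle η hK s hH hmH]
    exact congrArg (fun G => settled η G s) (by
      funext M n b
      exact hE ⟨M, n, b, false⟩)
  simp only [hset]
  refine (integral_traj_eq η hη hK hl t (settled η (pairLoss η (ℓ t)))).trans ?_
  simp only [avg_settled, mean_pairLoss η hK]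

/-- A communication step moves the counts into the base and leaves the total estimates unchanged, so
bounds in terms of these survive it. -/
theorem settled_le (hK : 2 ≤ K) {G : (Fin K → ℕ) → (Fin K → ℕ) → Fin K → ℝ}
    {h : (Fin K → ℕ) → ℝ} (hG : ∀ M n b, Fresh η M n → G M n b ≤ h (total η M n)) {s : State K}
    (hs : Good η s) : settled η G s ≤ h (total η s.base s.hits) := by
  unfold settled
  split_ifs with ha
  · have hp := isProb_marg η hK (total η s.base s.hits) fun _ => 0
    calc _ ≤ ∑ b, marg η (total η s.base s.hits) (fun _ => 0) b * h (total η s.base s.hits) :=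
          Finset.sum_le_sum fun b _ => mul_le_mul_of_nonneg_left
            ((hG _ _ b (fresh_zero η _)).trans_eq (by rw [total_zero])) (hp.1 b)
      _ = _ := by rw [← Finset.sum_mul, hp.2, one_mul]
  · exact hG _ _ _ (hs.resolve_left ha)

theorem kern_total (l : Fin K → ℝ) (h : (Fin K → ℕ) → ℝ) (M n : Fin K → ℕ) (b : Fin K) :
    kern η l (fun s => h (total η s.base s.hits)) M n b = h (total η M n) +
      ∑ e, l e / gain η M e * (h (Function.update (total η M n) e
        (total η M n e + gain η M e)) - h (total η M n)) := by
  simp only [kern, total_hit, mul_sub, Finset.sum_sub_distrib, ← Finset.sum_mul]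
  have : ∀ e, l e / gain η M e * (surv η M n b e * h (Function.update (total η M n) e
      (total η M n e + gain η M e)) + (1 - surv η M n b e) * h (Function.update (total η M n) e
      (total η M n e + gain η M e))) = l e / gain η M e * h (Function.update (total η M n) e
      (total η M n e + gain η M e)) := fun e => by ring
  simp only [this]
  ring

/-- The estimates are unbiased: a jump by `gain` has probability loss/`gain`. -/
theorem integral_total_le (hη : 0 ≤ η) (hK : 2 ≤ K) {ℓ : ℕ → Fin K → ℝ}
    (hl : ∀ t a, ℓ t a ∈ Set.Icc (0 : ℝ) 1) (i : Fin K) (T : ℕ) :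
    ∫ R, (total η (traj η ℓ R T).base (traj η ℓ R T).hits i : ℝ) ∂sharedLaw ≤
      ∑ t ∈ Finset.range T, ℓ t i := by
  induction T with
  | zero => simp [traj, run, start, total]
  | succ t ih =>
    rw [integral_traj_succ η hη hK hl t fun s => (total η s.base s.hits i : ℝ),
      Finset.sum_range_succ]
    have hle : ∀ R, settled η (kern η (ℓ t) fun s => (total η s.base s.hits i : ℝ)) (traj η ℓ R t) ≤
        (total η (traj η ℓ R t).base (traj η ℓ R t).hits i : ℝ) + ℓ t i := fun R => by
      refine settled_le η hK (h := fun L => (L i : ℝ) + ℓ t i) (fun M n b _ => ?_) (good_traj η ℓ R t)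
      rw [kern_total η (ℓ t) (fun L => (L i : ℝ))]
      refine (add_le_add_iff_left _).2 ?_
      rw [Finset.sum_eq_single i]
      · have := (gain_pos η M i).ne'
        simp only [Function.update_self]
        push_cast
        rw [add_sub_cancel_left, div_mul_cancel₀ _ this]
      · intro e _ he
        rw [Function.update_of_ne he.symm]
        simp
      · simp
    have hI := integrable_traj η ℓ t fun s => (total η s.base s.hits i : ℝ)
    refine (integral_mono (integrable_traj η ℓ t _) (hI.add (integrable_const _)) hle).trans ?_
    rw [integral_add' hI (integrable_const _)]
    simpa using ih

/-- The potential starts at most at log K². Each round lowers it by η times the expected pair loss,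
up to η²/2 times the bound 31K³. -/
theorem integral_log_pairSum_le (hη : 0 ≤ η) (hK : 2 ≤ K) {ℓ : ℕ → Fin K → ℝ}
    (hl : ∀ t a, ℓ t a ∈ Set.Icc (0 : ℝ) 1) (T : ℕ) :
    ∫ R, Real.log (pairSum η (total η (traj η ℓ R T).base (traj η ℓ R T).hits)) ∂sharedLaw +
      η * ∑ t ∈ Finset.range T, ∫ R, ∑ a, incl η (total η (traj η ℓ R t).base
        (traj η ℓ R t).hits) a * ℓ t a ∂sharedLaw ≤
      2 * Real.log K + T * (31 / 2 * η ^ 2 * K ^ 3) := by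
  induction T with
  | zero =>
    have h : total η (start K).base (start K).hits = fun _ => 0 := by funext a; simp [total, start]
    simp only [traj, run, h]
    simp
    calc _ ≤ Real.log ((K : ℝ) ^ 2) := Real.log_le_log (pairSum_pos η hK _) (pairSum_zero_le η)
      _ = _ := by simp
  | succ t ih =>
    rw [integral_traj_succ η hη hK hl t fun s => Real.log (pairSum η (total η s.base s.hits)),
      Finset.sum_range_succ]
    set V : State K → ℝ := fun s => Real.log (pairSum η (total η s.base s.hits))
    set D : State K → ℝ := fun s => ∑ a, incl η (total η s.base s.hits) a * ℓ t a
    have hle : ∀ R, settled η (kern η (ℓ t) V) (traj η ℓ R t) ≤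
        V (traj η ℓ R t) - η * D (traj η ℓ R t) + 31 / 2 * η ^ 2 * K ^ 3 := fun R => by
      refine settled_le η hK (h := fun L => Real.log (pairSum η L) -
        η * (∑ a, incl η L a * ℓ t a) + 31 / 2 * η ^ 2 * K ^ 3) (fun M n b hn => ?_)
        (good_traj η ℓ R t)
      rw [kern_total η (ℓ t) (fun L => Real.log (pairSum η L))]
      set L := total η M n
      have h1 : ∀ e, ℓ t e / gain η M e * (Real.log (pairSum η (Function.update L e
          (L e + gain η M e))) - Real.log (pairSum η L)) ≤
          -(η * (incl η L e * ℓ t e)) + η ^ 2 / 2 * (incl η L e * gain η M e) := by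
        intro e
        have hg := gain_pos η M e
        have h2 := log_pairSum_update_le η hη hK L e (gain η M e)
        have h3 : 0 ≤ ℓ t e / gain η M e := div_nonneg (hl t e).1 hg.le
        refine (mul_le_mul_of_nonneg_left (sub_le_iff_le_add'.2
          (h2.trans_eq (sub_eq_add_neg _ _))) h3).trans ?_
        have h4 : ℓ t e / gain η M e *
            -(incl η L e * (η * gain η M e - (η * gain η M e) ^ 2 / 2)) =
            -(η * (incl η L e * ℓ t e)) + η ^ 2 / 2 * (incl η L e * gain η M e) * ℓ t e := by
          field_simp
          ring
        rw [h4]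
        have h5 : 0 ≤ η ^ 2 / 2 * (incl η L e * gain η M e) :=
          mul_nonneg (by positivity) (mul_nonneg (incl_nonneg η hK L e) hg.le)
        linarith [mul_le_of_le_one_right h5 (hl t e).2]
      have h6 := Finset.sum_le_sum fun e (_ : e ∈ Finset.univ) => h1 e
      rw [Finset.sum_add_distrib, Finset.sum_neg_distrib, ← Finset.mul_sum, ← Finset.mul_sum] at h6
      have h7 := mul_le_mul_of_nonneg_left (Fresh.sum_incl_mul_gain_le η hη hK hn)
        (by positivity : 0 ≤ η ^ 2 / 2)
      change _ ≤ Real.log (pairSum η L) - _ + _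
      linarith
    have hV := integrable_traj η ℓ t V
    have hD := (integrable_traj η ℓ t D).const_mul η
    have h8 := integral_mono (integrable_traj η ℓ t _) ((hV.sub hD).add (integrable_const _)) hle
    have h9 : ∫ R, (V (traj η ℓ R t) - η * D (traj η ℓ R t) + 31 / 2 * η ^ 2 * K ^ 3) ∂sharedLaw =
        ∫ R, V (traj η ℓ R t) ∂sharedLaw - η * ∫ R, D (traj η ℓ R t) ∂sharedLaw +
          31 / 2 * η ^ 2 * K ^ 3 := by
      refine (integral_add (hV.sub hD) (integrable_const _)).trans ?_
      rw [integral_sub' hV hD, integral_const_mul]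
      simp
    have h10 := h8.trans_eq h9
    change _ + η * (_ + ∫ R, D (traj η ℓ R t) ∂sharedLaw) ≤ _
    change ∫ R, V (traj η ℓ R t) ∂sharedLaw + _ ≤ _ at ih
    push_cast
    linarith

theorem sum_integral_incl_le (hη : 0 < η) (hK : 2 ≤ K) {ℓ : ℕ → Fin K → ℝ}
    (hl : ∀ t a, ℓ t a ∈ Set.Icc (0 : ℝ) 1) {i j : Fin K} (hij : i ≠ j) (T : ℕ) :
    ∑ t ∈ Finset.range T, ∫ R, ∑ a, incl η (total η (traj η ℓ R t).base
        (traj η ℓ R t).hits) a * ℓ t a ∂sharedLaw ≤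
      ∑ t ∈ Finset.range T, (ℓ t i + ℓ t j) +
        (2 * Real.log K / η + T * (31 / 2 * η * K ^ 3)) := by
  have h1 := integral_log_pairSum_le η hη.le hK hl T
  have hi := integrable_traj η ℓ T fun s => (total η s.base s.hits i : ℝ)
  have hj := integrable_traj η ℓ T fun s => (total η s.base s.hits j : ℝ)
  have h2 := integral_mono ((hi.const_mul η).add (hj.const_mul η)).neg
    (integrable_traj η ℓ T fun s => Real.log (pairSum η (total η s.base s.hits)))
    fun R => neg_le_log_pairSum η _ hij
  have h3 : ∫ R, (-((fun R => η * (total η (traj η ℓ R T).base (traj η ℓ R T).hits i : ℝ)) +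
      fun R => η * (total η (traj η ℓ R T).base (traj η ℓ R T).hits j : ℝ))) R ∂sharedLaw =
      -(η * ∫ R, (total η (traj η ℓ R T).base (traj η ℓ R T).hits i : ℝ) ∂sharedLaw +
        η * ∫ R, (total η (traj η ℓ R T).base (traj η ℓ R T).hits j : ℝ) ∂sharedLaw) := by
    rw [integral_neg', integral_add' (hi.const_mul η) (hj.const_mul η), integral_const_mul,
      integral_const_mul]
  have h4 := h3.symm.le.trans h2
  have h5 := mul_le_mul_of_nonneg_left (integral_total_le η hη.le hK hl i T) hη.le
  have h6 := mul_le_mul_of_nonneg_left (integral_total_le η hη.le hK hl j T) hη.le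
  refine le_of_mul_le_mul_left ?_ hη
  have h7 : η * (∑ t ∈ Finset.range T, (ℓ t i + ℓ t j) +
      (2 * Real.log K / η + T * (31 / 2 * η * K ^ 3))) =
      η * ∑ t ∈ Finset.range T, ℓ t i + η * ∑ t ∈ Finset.range T, ℓ t j +
        (2 * Real.log K + T * (31 / 2 * η ^ 2 * K ^ 3)) := by
    rw [Finset.sum_add_distrib]
    field_simp
  rw [h7]
  linarith

/-- How far the loss estimates are from raising an alarm. -/
noncomputable def load (s : State K) : ℝ :=
  if s.alarm then 0 else ∑ a, η * gain η s.base a * s.hits a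

theorem load_nonneg (hη : 0 ≤ η) (s : State K) : 0 ≤ load η s := by
  unfold load
  split_ifs
  · exact le_rfl
  · exact Finset.sum_nonneg fun a _ => by positivity

/-- A threshold alarm costs 1, no more than the load that it wipes out plus the last jump. The
expected jumps sum to at most ηK, and rejections add 2η because each pair has two members. -/
theorem kern_load_le (hη : 0 ≤ η) (hK : 2 ≤ K) {l : Fin K → ℝ}
    (hl : ∀ a, l a ∈ Set.Icc (0 : ℝ) 1) (M n : Fin K → ℕ) (b : Fin K) :
    kern η l (fun s => (if s.alarm then 1 else 0) + load η s) M n b ≤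
      ∑ a, η * gain η M a * n a + η * (K + 2) := by
  set S := ∑ a, η * gain η M a * n a
  have hS : 0 ≤ S := Finset.sum_nonneg fun a _ => by positivity
  have hhit : ∀ e, ∑ a, η * gain η M a * (hit n e a : ℝ) = S + η * gain η M e := by
    intro e
    rw [← Finset.add_sum_erase _ _ (Finset.mem_univ e)]
    have h1 : S = η * gain η M e * n e + ∑ a ∈ Finset.univ.erase e, η * gain η M a * n a :=
      (Finset.add_sum_erase _ _ (Finset.mem_univ e)).symm
    rw [h1, Finset.sum_congr rfl fun a ha => by
      rw [hit, Function.update_of_ne (Finset.ne_of_mem_erase ha)]]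
    simp only [hit, Function.update_self]
    push_cast
    ring
  have hge : ∀ e, η * gain η M e * (n e + 1) ≤ S + η * gain η M e := by
    intro e
    have := Finset.single_le_sum (f := fun a => η * gain η M a * (n a : ℝ))
      (fun a _ => by positivity) (Finset.mem_univ e)
    linarith
  have h0 : ∀ e, (if (decide (1 ≤ η * gain η M e * (n e + 1)) : Bool) = true then (1 : ℝ) else 0) +
      load η ⟨M, hit n e, b, decide (1 ≤ η * gain η M e * (n e + 1))⟩ ≤ S + η * gain η M e := by
    intro e
    by_cases h : 1 ≤ η * gain η M e * (n e + 1)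
    · simp only [h, load, decide_true, if_true]
      linarith [hge e]
    · simp only [h, load, decide_false, Bool.false_eq_true, if_false]
      linarith [hhit e]
  set p : Fin K → ℝ := fun e => if e = b then 1 else cond η M n b e
  have hp : ∑ e, p e = 2 := by
    have : ∀ e, p e = (if e = b then 1 else 0) + cond η M n b e := by
      intro e
      by_cases h : e = b
      · simp [p, h, cond_self]
      · simp [p, h]
    simp only [this, Finset.sum_add_distrib, (isProb_cond η hK M n b).2]
    simp
    norm_num
  have hterm : ∀ e, l e / gain η M e * (surv η M n b e *
      ((if (decide (1 ≤ η * gain η M e * (n e + 1)) : Bool) = true then (1 : ℝ) else 0) +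
        load η ⟨M, hit n e, b, decide (1 ≤ η * gain η M e * (n e + 1))⟩) +
        (1 - surv η M n b e) * 1) ≤ l e / gain η M e * S + η + η * p e := by
    intro e
    have hg := gain_pos η M e
    have hq : 0 ≤ l e / gain η M e := div_nonneg (hl e).1 hg.le
    have hp0 : 0 ≤ p e := by
      simp only [p]
      split_ifs
      · exact zero_le_one
      · exact cond_nonneg η hK M n b e
    have h1 : surv η M n b e *
      ((if (decide (1 ≤ η * gain η M e * (n e + 1)) : Bool) = true then (1 : ℝ) else 0) +
        load η ⟨M, hit n e, b, decide (1 ≤ η * gain η M e * (n e + 1))⟩) ≤ S + η * gain η M e :=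
      (mul_le_mul_of_nonneg_left (h0 e) (surv_nonneg η hK M n b e)).trans
        (mul_le_of_le_one_left (add_nonneg hS (by positivity)) (surv_le_one η hη hK M n b e))
    have h2 : 1 - surv η M n b e ≤ p e * (η * gain η M e) := one_sub_surv_le η hK M n b e
    refine (mul_le_mul_of_nonneg_left (add_le_add h1 ((mul_one _).trans_le h2)) hq).trans ?_
    have h3 : l e / gain η M e * (S + η * gain η M e + p e * (η * gain η M e)) =
        l e / gain η M e * S + η * l e + η * p e * l e := by
      field_simp
    rw [h3]
    have h4 := mul_le_of_le_one_right hη (hl e).2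
    have h5 := mul_le_of_le_one_right (mul_nonneg hη hp0) (hl e).2
    linarith
  have hlast : (if (false : Bool) = true then (1 : ℝ) else 0) + load η ⟨M, n, b, false⟩ = S := by
    simp [load, S]
  have htrue : ∀ e, 1 + load η ⟨M, hit n e, b, true⟩ = 1 := by
    intro e
    simp [load]
  unfold kern
  simp only [hlast, if_true, htrue]
  refine (add_le_add (Finset.sum_le_sum fun e _ => hterm e) le_rfl).trans ?_
  rw [Finset.sum_add_distrib, Finset.sum_add_distrib, ← Finset.sum_mul, ← Finset.mul_sum, hp]
  simp only [Finset.sum_const, Finset.card_univ, Fintype.card_fin, nsmul_eq_mul]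
  exact le_of_eq (by ring)

/-- Alarms so far plus current load grow by at most η(K + 2) in expectation per round; the leading 1
is the initial alarm. -/
theorem sum_integral_alarm_le (hη : 0 ≤ η) (hK : 2 ≤ K) {ℓ : ℕ → Fin K → ℝ}
    (hl : ∀ t a, ℓ t a ∈ Set.Icc (0 : ℝ) 1) (T : ℕ) :
    ∑ t ∈ Finset.range T, ∫ R, (if (traj η ℓ R t).alarm then (1 : ℝ) else 0) ∂sharedLaw ≤
      1 + T * (η * (K + 2)) := by
  have key : ∀ T : ℕ, ∑ t ∈ Finset.range (T + 1),
      ∫ R, (if (traj η ℓ R t).alarm then (1 : ℝ) else 0) ∂sharedLaw +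
        ∫ R, load η (traj η ℓ R T) ∂sharedLaw ≤ 1 + T * (η * (K + 2)) := by
    intro T
    induction T with
    | zero => simp [traj, run, start, load]
    | succ t ih =>
      rw [Finset.sum_range_succ, add_assoc, ← integral_add
        (integrable_traj η ℓ (t + 1) fun s => if s.alarm then (1 : ℝ) else 0)
        (integrable_traj η ℓ (t + 1) (load η)),
        integral_traj_succ η hη hK hl t fun s => (if s.alarm then 1 else 0) + load η s]
      have hle : ∀ R, settled η (kern η (ℓ t) fun s => (if s.alarm then 1 else 0) + load η s)
          (traj η ℓ R t) ≤ load η (traj η ℓ R t) + η * (K + 2) := by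
        intro R
        set s := traj η ℓ R t
        rcases hs : s.alarm with _ | _
        · simp only [settled, load, hs, Bool.false_eq_true, if_false]
          exact kern_load_le η hη hK (hl t) _ _ _
        · have hp := isProb_marg η hK (total η s.base s.hits) fun _ => 0
          have h1 := fun b => kern_load_le η hη hK (hl t) (total η s.base s.hits) (fun _ => 0) b
          simp only [Nat.cast_zero, mul_zero, Finset.sum_const_zero, zero_add] at h1
          simp only [settled, load, hs, if_true, zero_add]
          calc _ ≤ ∑ b, marg η (total η s.base s.hits) (fun _ => 0) b * (η * (K + 2)) :=
                Finset.sum_le_sum fun b _ => mul_le_mul_of_nonneg_left (h1 b) (hp.1 b)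
            _ = _ := by rw [← Finset.sum_mul, hp.2, one_mul]
      have h2 := integral_mono (integrable_traj η ℓ t _)
        ((integrable_traj η ℓ t (load η)).add (integrable_const _)) hle
      rw [integral_add' (integrable_traj η ℓ t (load η)) (integrable_const _)] at h2
      simp only [integral_const, probReal_univ, smul_eq_mul, one_mul] at h2
      push_cast
      linarith
  cases T with
  | zero => simp
  | succ T =>
    have h1 := key T
    have h2 : 0 ≤ ∫ R, load η (traj η ℓ R T) ∂sharedLaw :=
      integral_nonneg fun R => load_nonneg η hη _
    have h3 : 0 ≤ η * (K + 2 : ℝ) := by positivity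
    push_cast
    linarith

end Analysis

/-! ### Messages and their encoding -/

instance : DiscreteMeasurableSpace Exchange := ⟨fun _ => trivial⟩

instance : Countable Exchange :=
  Function.Injective.countable (β := Option (List Bool × List Bool × List Bool))
    (f := fun x => match x with
      | .silent => none
      | .talk m m' m'' => some (m, m', m'')) fun x y h => by
        cases x <;> cases y <;> simp_all

instance : DiscreteMeasurableSpace (List Bool) := ⟨fun _ => trivial⟩

section Encoding

variable {K : ℕ}

/-- The binary expansions of the numbers `n a`, if they are at most `t`. -/
def encode (t : ℕ) (n : Fin K → ℕ) : List Bool :=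
  List.ofFn fun j : Fin (K * Nat.size t) =>
    (n (finProdFinEquiv.symm j).1).testBit (finProdFinEquiv.symm j).2

/-- Inverts `encode`. -/
noncomputable def decode (t : ℕ) (w : List Bool) : Fin K → ℕ :=
  Function.invFunOn (encode t) {n : Fin K → ℕ | ∀ a, n a ≤ t} w

theorem length_encode (t : ℕ) (n : Fin K → ℕ) : (encode t n).length = K * Nat.size t := by
  simp [encode]

theorem injOn_encode (t : ℕ) : Set.InjOn (encode t) {n : Fin K → ℕ | ∀ a, n a ≤ t} := by
  intro n hn n' hn' h
  have h1 := List.ofFn_injective h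
  funext a
  refine Nat.eq_of_testBit_eq fun i => ?_
  by_cases hi : i < Nat.size t
  · have h2 := congrFun h1 (finProdFinEquiv (a, ⟨i, hi⟩))
    simpa using h2
  · have h3 : t < 2 ^ i :=
      (Nat.lt_size_self t).trans_le (Nat.pow_le_pow_right (by norm_num) (not_lt.1 hi))
    rw [Nat.testBit_lt_two_pow ((hn a).trans_lt h3), Nat.testBit_lt_two_pow ((hn' a).trans_lt h3)]

theorem decode_encode {t : ℕ} {n : Fin K → ℕ} (hn : ∀ a, n a ≤ t) : decode t (encode t n) = n :=
  (injOn_encode t).leftInvOn_invFunOn hn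

end Encoding

/-! ### The players' private views and the strategy -/

section Players

theorem suffered_of_ne {K : ℕ} {l : Fin K → ℝ} (hl : ∀ a, l a ∈ Set.Icc (0 : ℝ) 1) {a b : Fin K}
    (h : a ≠ b) : suffered l a b = l a := by
  rw [suffered, if_neg h, max_eq_left (hl a).1]

variable {K : ℕ} [NeZero K] (η : ℝ)

/-- How a player updates the state after an exchange. -/
noncomputable def hear (t : ℕ) (s : State K) (x : Exchange) (u : unitInterval) : State K :=
  match x with
  | .silent => s
  | .talk m m' _ => draw η (total η s.base fun a => decode t m a + decode t m' a) u

/-- How a player updates the state during a round; `isA` tells whether the player is Alice. -/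
noncomputable def localStep (isA : Bool) (t : ℕ) (s : State K) (r : unitInterval) (o : Obs) :
    State K :=
  record η (hear η t s o.1 (split r).1)
    (if isA then decide (aliceMove η (hear η t s o.1 (split r).1) (split r).2.2.1 =
        pick (unif K) (split r).2.1)
      else decide (pick (unif K) (split r).2.1 = (hear η t s o.1 (split r).1).pos))
    (pick (unif K) (split r).2.1) o.2.1 (split r).2.2.2

/-- The state from the point of view of one player, before round `t`. -/
noncomputable def localState (isA : Bool) :
    (t : ℕ) → (Fin t → unitInterval) → (Fin t → Obs) → State K
  | 0, _, _ => start K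
  | t + 1, R, o => localStep η isA t
      (localState isA t (fun s => R s.castSucc) fun s => o s.castSucc) (R (Fin.last t))
      (o (Fin.last t))

theorem measurable_hear (t : ℕ) : Measurable fun p : (State K × Exchange) × unitInterval =>
    hear η t p.1.1 p.1.2 p.2 := by
  refine measurable_from_prod_countable_right fun q => ?_
  rcases q with ⟨s, _ | ⟨m, m', m''⟩⟩
  · exact measurable_const
  · exact (Measurable.of_discrete (f := fun b : Fin K => (⟨total η s.base fun a =>
      decode t m a + decode t m' a, fun _ => 0, b, false⟩ : State K))).comp
      (measurable_pick (marg η (total η s.base fun a => decode t m a + decode t m' a) fun _ => 0))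

theorem measurable_localStep (isA : Bool) (t : ℕ) :
    Measurable fun p : State K × unitInterval × Obs => localStep η isA t p.1 p.2.1 p.2.2 := by
  have hs : Measurable fun p : State K × unitInterval × Obs =>
      hear η t p.1 p.2.2.1 (split p.2.1).1 :=
    (measurable_hear η t).comp ((measurable_fst.prodMk measurable_snd.snd.fst).prodMk
      (measurable_split.comp measurable_snd.fst).fst)
  have he : Measurable fun p : State K × unitInterval × Obs => pick (unif K) (split p.2.1).2.1 :=
    (measurable_pick _).comp (measurable_split.comp measurable_snd.fst).snd.fst
  have ha : Measurable fun p : State K × unitInterval × Obs =>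
      aliceMove η (hear η t p.1 p.2.2.1 (split p.2.1).1) (split p.2.1).2.2.1 :=
    (measurable_aliceMove η).comp (hs.prodMk (measurable_split.comp measurable_snd.fst).snd.snd.fst)
  have hd : Measurable fun q : State K × Fin K × Fin K => ((q.1, if isA then decide (q.2.2 = q.2.1)
      else decide (q.2.1 = q.1.pos), q.2.1) : State K × Bool × Fin K) := Measurable.of_discrete
  have hq := hd.comp (hs.prodMk (he.prodMk ha))
  exact (measurable_record η).comp (hq.prodMk (measurable_snd.snd.snd.fst.prodMk
    (measurable_split.comp measurable_snd.fst).snd.snd.snd))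

theorem measurable_localState (isA : Bool) (t : ℕ) :
    Measurable fun p : (Fin t → unitInterval) × (Fin t → Obs) =>
      (localState η isA t p.1 p.2 : State K) := by
  induction t with
  | zero => exact measurable_const
  | succ t ih =>
    have h1 : Measurable fun p : (Fin (t + 1) → unitInterval) × (Fin (t + 1) → Obs) =>
        ((fun s : Fin t => p.1 s.castSucc, fun s : Fin t => p.2 s.castSucc) :
          (Fin t → unitInterval) × (Fin t → Obs)) :=
      (measurable_pi_lambda _ fun s => (measurable_pi_apply s.castSucc).comp measurable_fst).prodMk
        (measurable_pi_lambda _ fun s => (measurable_pi_apply s.castSucc).comp measurable_snd)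
    have h2 : Measurable fun p : (Fin (t + 1) → unitInterval) × (Fin (t + 1) → Obs) =>
        p.1 (Fin.last t) := (measurable_pi_apply (Fin.last t)).comp measurable_fst
    have h3 : Measurable fun p : (Fin (t + 1) → unitInterval) × (Fin (t + 1) → Obs) =>
        p.2 (Fin.last t) := (measurable_pi_apply (Fin.last t)).comp measurable_snd
    have h4 : Measurable fun p : (Fin (t + 1) → unitInterval) × (Fin (t + 1) → Obs) =>
        ((localState η isA t (fun s => p.1 s.castSucc) fun s => p.2 s.castSucc, p.1 (Fin.last t),
          p.2 (Fin.last t)) : State K × unitInterval × Obs) := by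
      refine Measurable.prodMk ?_ (h2.prodMk h3)
      exact ih.comp h1
    simp only [localState]
    have h5 := (measurable_localStep η isA t).comp h4
    simpa only [Function.comp_def] using h5

/-- The state from the point of view of one player, as a function of what the player knows. -/
noncomputable def infoState (isA : Bool) (t : ℕ) (i : Info t) : State K :=
  localState η isA t (fun s => i.1 s.castSucc) i.2

theorem measurable_infoState (isA : Bool) (t : ℕ) :
    Measurable (infoState η isA t : Info t → State K) := by
  have h1 : Measurable fun i : Info t => ((fun s : Fin t => i.1 s.castSucc, i.2) :
      (Fin t → unitInterval) × (Fin t → Obs)) :=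
    (measurable_pi_lambda _ fun s => (measurable_pi_apply s.castSucc).comp measurable_fst).prodMk
      measurable_snd
  exact (measurable_localState η isA t).comp h1

theorem measurable_hear_infoState (isA : Bool) (t : ℕ) : Measurable fun p : Info t × Exchange =>
    hear η t (infoState η isA t p.1 : State K) p.2 (split (p.1.1 (Fin.last t))).1 :=
  (measurable_hear η t).comp ((((measurable_infoState η isA t).comp measurable_fst).prodMk
    measurable_snd).prodMk (measurable_split.comp
      ((measurable_pi_apply (Fin.last t)).comp measurable_fst.fst)).fst)

/-- The strategy: Bob keeps his action until an alarm is raised, Alice samples her action anew in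
every round, and in communication steps the two players tell each other how often they have
recorded losses. -/
noncomputable def lazyStrategy : Strategy K where
  callA t i := (infoState η true t i : State K).alarm
  callB t i := (infoState η false t i : State K).alarm
  first t i := encode t (infoState η true t i : State K).hits
  reply t i := encode t (infoState η false t i.1 : State K).hits
  closing _ _ := []
  actA t i := aliceMove η (hear η t (infoState η true t i.1) i.2 (split (i.1.1 (Fin.last t))).1)
    (split (i.1.1 (Fin.last t))).2.2.1
  actB t i := (hear η t (infoState η false t i.1) i.2 (split (i.1.1 (Fin.last t))).1).pos
  measurable_callA t := (Measurable.of_discrete (f := State.alarm)).comp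
    (measurable_infoState η true t)
  measurable_callB t := (Measurable.of_discrete (f := State.alarm)).comp
    (measurable_infoState η false t)
  measurable_first t := (Measurable.of_discrete (f := fun s : State K => encode t s.hits)).comp
    (measurable_infoState η true t)
  measurable_reply t := ((Measurable.of_discrete (f := fun s : State K => encode t s.hits)).comp
    (measurable_infoState η false t)).comp measurable_fst
  measurable_closing _ := measurable_const
  measurable_actA t := (measurable_aliceMove η).comp ((measurable_hear_infoState η true t).prodMk
    (measurable_split.comp
      ((measurable_pi_apply (Fin.last t)).comp measurable_fst.fst)).snd.snd.fst)
  measurable_actB t := (Measurable.of_discrete (f := State.pos)).comp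
    (measurable_hear_infoState η false t)

/-- The joint state `s` in terms of the states `sA` and `sB` of the two players. -/
structure Joint (t : ℕ) (s sA sB : State K) : Prop where
  baseA : sA.base = s.base
  baseB : sB.base = s.base
  posA : sA.pos = s.pos
  posB : sB.pos = s.pos
  hitsA : ∀ a, sA.hits a = if a = s.pos then 0 else s.hits a
  hitsB : ∀ a, sB.hits a = if a = s.pos then s.hits a else 0
  alarm : s.alarm = (sA.alarm || sB.alarm)
  le : ∀ a, s.hits a ≤ t

/-- The exchange that results from the states of the two players. -/
def talkOf (t : ℕ) (s sA sB : State K) : Exchange :=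
  if s.alarm then .talk (encode t sA.hits) (encode t sB.hits) [] else .silent

variable {η}

/-- The counts of the two players have disjoint supports, so their sum is the joint count; the bound
by `t` makes decoding exact. -/
theorem Joint.hear {t : ℕ} {s sA sB : State K} (h : Joint t s sA sB) (u : unitInterval) :
    Joint t (settle η s u) (hear η t sA (talkOf t s sA sB) u)
      (hear η t sB (talkOf t s sA sB) u) := by
  rcases hs : s.alarm with _ | _
  · simpa only [settle, talkOf, hs, Bool.false_eq_true, if_false, CommBandit.hear] using h
  · have h1 : (fun a => decode t (encode t sA.hits) a + decode t (encode t sB.hits) a) = s.hits := by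
      rw [decode_encode, decode_encode]
      · funext a
        rw [h.hitsA, h.hitsB]
        split_ifs <;> simp
      · intro a
        rw [h.hitsB]
        split_ifs
        · exact h.le a
        · exact Nat.zero_le t
      · intro a
        rw [h.hitsA]
        split_ifs
        · exact Nat.zero_le t
        · exact h.le a
    simp only [settle, talkOf, hs, if_true, CommBandit.hear, h1, h.baseA, h.baseB]
    exact ⟨rfl, rfl, rfl, rfl, fun a => (ite_self 0).symm, fun a => (ite_self 0).symm, rfl,
      fun a => Nat.zero_le t⟩

theorem Joint.aliceMove {t : ℕ} {s sA sB : State K} (h : Joint t s sA sB) (u : unitInterval) :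
    aliceMove η sA u = aliceMove η s u := by
  rw [CommBandit.aliceMove, CommBandit.aliceMove, h.baseA, h.posA,
    cond_congr η fun a ha => by rw [h.hitsA, if_neg ha]]

theorem aliceMove_ne (hK : 2 ≤ K) (s : State K) (u : unitInterval) : CommBandit.aliceMove η s u ≠ s.pos :=
  fun h => (isProb_cond η hK s.base s.hits s.pos).pick_ne_zero u (by
    change cond η s.base s.hits s.pos (CommBandit.aliceMove η s u) = 0
    rw [h, cond_self])

theorem record_false (s : State K) (e : Fin K) (y : ℝ) (u : unitInterval) :
    record η s false e y u = ⟨s.base, s.hits, s.pos, false⟩ := by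
  simp [record]

/-- At most one player plays the public action, and only this one changes counts or raises an alarm,
with the same probabilities as in the joint state. The loss seen by the other player is ignored. -/
theorem Joint.record {t : ℕ} {s sA sB : State K} (h : Joint t s sA sB) {a e : Fin K}
    (ha : a ≠ s.pos) (l : Fin K → ℝ) (u : unitInterval) :
    Joint (t + 1) (record η s (decide (e = s.pos ∨ a = e)) e (l e) u)
      (record η sA (decide (a = e)) e (l a) u) (record η sB (decide (e = sB.pos)) e (l s.pos) u) := by
  obtain ⟨M, n, b, d⟩ := s
  obtain ⟨MA, nA, bA, dA⟩ := sA
  obtain ⟨MB, nB, bB, dB⟩ := sB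
  obtain ⟨h1, h2, h3, h4, h5, h6, -, h8⟩ := h
  simp only at h1 h2 h3 h4 h5 h6 h8 ha
  subst h1 h2 h3 h4
  have hle : ∀ c, hit n e c ≤ t + 1 := fun c => by
    by_cases hc : c = e
    · subst hc
      simpa [hit] using h8 c
    · simpa [hit, hc] using (h8 c).trans (Nat.le_succ t)
  by_cases he : e = bB
  · subst he
    have hae : decide (a = e) = false := decide_eq_false ha
    have hn : nB e = n e := by rw [h6, if_pos rfl]
    simp only [true_or, decide_true, hae, record_false]
    have hA : ∀ c, nA c = if c = e then 0 else hit n e c := fun c => by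
      by_cases hc : c = e <;> simp [h5, hit, hc]
    have hB : ∀ c, hit nB e c = if c = e then hit n e c else 0 := fun c => by
      by_cases hc : c = e
      · subst hc
        simp [hit, hn]
      · simp [h6, hit, hc]
    unfold CommBandit.record
    simp only [chance, surv, if_true, hn]
    split_ifs
    · exact ⟨rfl, rfl, rfl, rfl, hA, hB, rfl, hle⟩
    · exact ⟨rfl, rfl, rfl, rfl, hA, hB, rfl, hle⟩
    · exact ⟨rfl, rfl, rfl, rfl, h5, h6, rfl, fun c => (h8 c).trans (Nat.le_succ t)⟩
  · have heb : decide (e = bB) = false := decide_eq_false he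
    by_cases hae : a = e
    · subst hae
      have hoff : ∀ c, c ≠ bB → nA c = n c := fun c hc => by rw [h5, if_neg hc]
      simp only [or_true, decide_true, heb, record_false]
      have hA : ∀ c, hit nA a c = if c = bB then 0 else hit n a c := fun c => by
        by_cases hc : c = a
        · subst hc
          simp [hit, he, hoff c he]
        · simp [hit, hc, h5]
      have hB : ∀ c, nB c = if c = bB then hit n a c else 0 := fun c => by
        by_cases hc : c = bB
        · subst hc
          simp [hit, h6, ha.symm]
        · simp [h6, hc]
      unfold CommBandit.record
      simp only [chance, cond_congr η hoff, surv_congr η hoff, hoff a he]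
      split_ifs
      · exact ⟨rfl, rfl, rfl, rfl, hA, hB, rfl, hle⟩
      · exact ⟨rfl, rfl, rfl, rfl, hA, hB, rfl, hle⟩
      · exact ⟨rfl, rfl, rfl, rfl, h5, h6, rfl, fun c => (h8 c).trans (Nat.le_succ t)⟩
    · have hor : decide (e = bB ∨ a = e) = false := by simp [he, hae]
      have hae' : decide (a = e) = false := decide_eq_false hae
      simp only [hor, hae', heb, record_false]
      exact ⟨rfl, rfl, rfl, rfl, h5, h6, rfl, fun c => (h8 c).trans (Nat.le_succ t)⟩

variable (η)

/-- The state of a player before round `t`. -/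
noncomputable def playerState (isA : Bool) (ℓ : ℕ → Fin K → ℝ) (R : ℕ → unitInterval) (t : ℕ) :
    State K :=
  infoState η isA t (if isA then (lazyStrategy η : Strategy K).infoA ℓ R t
    else (lazyStrategy η : Strategy K).infoB ℓ R t)

theorem exchange_eq {ℓ : ℕ → Fin K → ℝ} {R : ℕ → unitInterval} {t : ℕ}
    (h : Joint t (traj η ℓ R t) (playerState η true ℓ R t) (playerState η false ℓ R t)) :
    (lazyStrategy η : Strategy K).exchange ℓ R t =
      talkOf t (traj η ℓ R t) (playerState η true ℓ R t) (playerState η false ℓ R t) := by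
  rw [talkOf, h.alarm]
  rfl

theorem bob_eq {ℓ : ℕ → Fin K → ℝ} {R : ℕ → unitInterval} {t : ℕ}
    (h : Joint t (traj η ℓ R t) (playerState η true ℓ R t) (playerState η false ℓ R t)) :
    (lazyStrategy η : Strategy K).bob ℓ R t =
      (settle η (traj η ℓ R t) (split (R t)).1).pos := by
  rw [← (h.hear (split (R t)).1).posB, ← exchange_eq η h]
  rfl

theorem alice_eq {ℓ : ℕ → Fin K → ℝ} {R : ℕ → unitInterval} {t : ℕ}
    (h : Joint t (traj η ℓ R t) (playerState η true ℓ R t) (playerState η false ℓ R t)) :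
    (lazyStrategy η : Strategy K).alice ℓ R t =
      aliceMove η (settle η (traj η ℓ R t) (split (R t)).1) (split (R t)).2.2.1 := by
  rw [← (h.hear (split (R t)).1).aliceMove, ← exchange_eq η h]
  rfl

theorem playerState_succ (isA : Bool) (ℓ : ℕ → Fin K → ℝ) (R : ℕ → unitInterval) (t : ℕ) :
    playerState η isA ℓ R (t + 1) = localStep η isA t (playerState η isA ℓ R t) (R t)
      ((lazyStrategy η : Strategy K).exchange ℓ R t,
        if isA then suffered (ℓ t) ((lazyStrategy η : Strategy K).alice ℓ R t)
            ((lazyStrategy η : Strategy K).bob ℓ R t)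
          else suffered (ℓ t) ((lazyStrategy η : Strategy K).bob ℓ R t)
            ((lazyStrategy η : Strategy K).alice ℓ R t),
        decide ((lazyStrategy η : Strategy K).alice ℓ R t =
          (lazyStrategy η : Strategy K).bob ℓ R t)) := by
  cases isA
  · simp only [playerState, infoState, localState, Strategy.infoB, Strategy.records,
      Bool.false_eq_true, if_false, Fin.snoc_castSucc, Fin.snoc_last]
    rfl
  · simp only [playerState, infoState, localState, Strategy.infoA, Strategy.records,
      if_true, Fin.snoc_castSucc, Fin.snoc_last]
    rfl

/-- Without collisions the suffered loss is the true loss of the action, so the private states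
follow the joint process for every realization of the randomness. -/
theorem joint_traj (hK : 2 ≤ K) {ℓ : ℕ → Fin K → ℝ} (hl : ∀ t a, ℓ t a ∈ Set.Icc (0 : ℝ) 1)
    (R : ℕ → unitInterval) (t : ℕ) :
    Joint t (traj η ℓ R t) (playerState η true ℓ R t) (playerState η false ℓ R t) := by
  induction t with
  | zero => exact ⟨rfl, rfl, rfl, rfl, fun a => (ite_self 0).symm,
      fun a => (ite_self 0).symm, rfl,
      fun a => le_rfl⟩
  | succ t ih =>
    have hne := aliceMove_ne (η := η) hK (settle η (traj η ℓ R t) (split (R t)).1) (split (R t)).2.2.1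
    have h := (ih.hear (split (R t)).1).record (η := η) (e := pick (unif K) (split (R t)).2.1) hne
      (ℓ t) (split (R t)).2.2.2
    rw [playerState_succ, playerState_succ, bob_eq η ih, alice_eq η ih, exchange_eq η ih]
    simp only [localStep, if_true, Bool.false_eq_true, if_false, suffered_of_ne (hl t) hne,
      suffered_of_ne (hl t) hne.symm, (ih.hear (split (R t)).1).aliceMove]
    exact h

end Players

/-! ### The four guarantees for a general learning rate -/

section Main

variable {K : ℕ} [NeZero K] (η : ℝ)

theorem alice_ne_bob (hK : 2 ≤ K) {ℓ : ℕ → Fin K → ℝ} (hl : ∀ t a, ℓ t a ∈ Set.Icc (0 : ℝ) 1)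
    (R : ℕ → unitInterval) (t : ℕ) :
    (lazyStrategy η : Strategy K).alice ℓ R t ≠ (lazyStrategy η : Strategy K).bob ℓ R t := by
  rw [bob_eq η (joint_traj η hK hl R t), alice_eq η (joint_traj η hK hl R t)]
  exact aliceMove_ne hK _ _

theorem regret_le (hη : 0 < η) (hK : 2 ≤ K) {ℓ : ℕ → Fin K → ℝ}
    (hl : ∀ t a, ℓ t a ∈ Set.Icc (0 : ℝ) 1) (T : ℕ) :
    (lazyStrategy η : Strategy K).regret T ℓ ≤
      2 * Real.log K / η + T * (31 / 2 * η * K ^ 3) := by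
  have : Nonempty {p : Fin K × Fin K // p.1 ≠ p.2} :=
    ⟨⟨(⟨0, by omega⟩, ⟨1, by omega⟩), by simp⟩⟩
  refine ciSup_le fun p => ?_
  have hI := fun t => (integral_pairLoss η hη.le hK hl t).1
  have h1 : ∀ R, ∑ t ∈ Finset.range T,
      (suffered (ℓ t) ((lazyStrategy η : Strategy K).alice ℓ R t)
          ((lazyStrategy η : Strategy K).bob ℓ R t)
        + suffered (ℓ t) ((lazyStrategy η : Strategy K).bob ℓ R t)
          ((lazyStrategy η : Strategy K).alice ℓ R t)
        - (ℓ t p.1.1 + ℓ t p.1.2)) = ∑ t ∈ Finset.range T,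
      ((ℓ t (settle η (traj η ℓ R t) (split (R t)).1).pos +
        ℓ t (aliceMove η (settle η (traj η ℓ R t) (split (R t)).1) (split (R t)).2.2.1)) -
        (ℓ t p.1.1 + ℓ t p.1.2)) := fun R => Finset.sum_congr rfl fun t _ => by
    have hne := alice_ne_bob η hK hl R t
    rw [suffered_of_ne (hl t) hne, suffered_of_ne (hl t) hne.symm,
      bob_eq η (joint_traj η hK hl R t), alice_eq η (joint_traj η hK hl R t), add_comm (ℓ t _)]
  simp only [h1]
  refine (integral_finsetSum _ fun t _ =>
    (hI t).sub (integrable_const (ℓ t p.1.1 + ℓ t p.1.2))).trans_le ?_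
  have h2 : ∀ t, ∫ R : ℕ → unitInterval, ((ℓ t (settle η (traj η ℓ R t) (split (R t)).1).pos +
        ℓ t (aliceMove η (settle η (traj η ℓ R t) (split (R t)).1) (split (R t)).2.2.1)) -
        (ℓ t p.1.1 + ℓ t p.1.2)) ∂sharedLaw = ∫ R, ∑ a, incl η (total η (traj η ℓ R t).base
          (traj η ℓ R t).hits) a * ℓ t a ∂sharedLaw - (ℓ t p.1.1 + ℓ t p.1.2) := fun t => by
    rw [integral_sub (hI t) (integrable_const _), (integral_pairLoss η hη.le hK hl t).2]
    simp
  simp only [Pi.sub_apply, h2]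
  rw [Finset.sum_sub_distrib]
  linarith [sum_integral_incl_le η hη hK hl p.2 T]

theorem expectedCommunications_le (hη : 0 ≤ η) (hK : 2 ≤ K) {ℓ : ℕ → Fin K → ℝ}
    (hl : ∀ t a, ℓ t a ∈ Set.Icc (0 : ℝ) 1) (T : ℕ) :
    (lazyStrategy η : Strategy K).expectedCommunications T ℓ ≤ 1 + T * (η * (K + 2)) := by
  have h1 : ∀ R t, (((lazyStrategy η : Strategy K).exchange ℓ R t).count : ℝ) =
      if (traj η ℓ R t).alarm then (1 : ℝ) else 0 := fun R t => by
    rw [exchange_eq η (joint_traj η hK hl R t), talkOf]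
    split_ifs <;> simp [Exchange.count]
  simp only [Strategy.expectedCommunications, h1]
  rw [integral_finsetSum _ fun t _ => integrable_traj η ℓ t fun s => if s.alarm then (1 : ℝ) else 0]
  exact sum_integral_alarm_le η hη hK hl T

/-- Uses log 2 > 1/2. Round 0 needs zero bits, which matters when `T = 1` and the logarithm
vanishes. -/
theorem size_le_log {t T : ℕ} (h : t < T) : (Nat.size t : ℝ) ≤ 4 * Real.log T := by
  rcases Nat.eq_zero_or_pos t with rfl | ht
  · simpa using Real.log_nonneg (by exact_mod_cast h : (1 : ℝ) ≤ T)
  · obtain ⟨m, hm⟩ : ∃ m, Nat.size t = m + 1 :=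
      Nat.exists_eq_succ_of_ne_zero (Nat.size_pos.2 ht).ne'
    have h1 : 2 ^ m ≤ t := Nat.lt_size.1 (by omega)
    have h2 : (2 : ℝ) ^ m ≤ T := by exact_mod_cast h1.trans h.le
    have h3 := Real.log_le_log (by positivity) h2
    rw [Real.log_pow] at h3
    have h4 : Real.log 2 ≤ Real.log T :=
      Real.log_le_log (by norm_num) (by exact_mod_cast (by omega : 2 ≤ T))
    have h5 := Real.log_two_gt_d9
    rw [hm]
    push_cast
    have h6 : (m : ℝ) * (1 / 2) ≤ m * Real.log 2 :=
      mul_le_mul_of_nonneg_left (by linarith) (Nat.cast_nonneg m)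
    linarith

theorem bits_le (hK : 2 ≤ K) {ℓ : ℕ → Fin K → ℝ} (hl : ∀ t a, ℓ t a ∈ Set.Icc (0 : ℝ) 1)
    (R : ℕ → unitInterval) {t T : ℕ} (h : t < T) :
    (((lazyStrategy η : Strategy K).exchange ℓ R t).bits : ℝ) ≤ 8 * K * Real.log T := by
  have hlog := size_le_log h
  have h0 : (0 : ℝ) ≤ Nat.size t := Nat.cast_nonneg _
  have hK0 : (0 : ℝ) ≤ K := Nat.cast_nonneg K
  rw [exchange_eq η (joint_traj η hK hl R t), talkOf]
  split_ifs
  · simp only [Exchange.bits, length_encode, List.length_nil]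
    push_cast
    nlinarith [mul_le_mul_of_nonneg_left hlog hK0]
  · simp only [Exchange.bits, Nat.cast_zero]
    have : 0 ≤ Real.log T := by linarith
    positivity

end Main

end CommBandit

/-! ### Choice of the learning rate -/

theorem mainTheorem2 :
    ∃ C : ℝ, ∀ K T : ℕ, 2 ≤ K → 1 ≤ T → ∃ σ : CommBandit.Strategy K,
      ∀ ℓ : ℕ → Fin K → ℝ, (∀ t a, ℓ t a ∈ Set.Icc (0 : ℝ) 1) →
        (∀ (R : ℕ → unitInterval) (t : ℕ), t < T → σ.alice ℓ R t ≠ σ.bob ℓ R t) ∧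
        σ.regret T ℓ ≤ 2 ^ 9 * (K : ℝ) ^ (3 / 2 : ℝ) * Real.log K * √(T : ℝ) ∧
        σ.expectedCommunications T ℓ ≤ (K : ℝ) ^ (3 / 2 : ℝ) * √(T : ℝ) ∧
        (∀ (R : ℕ → unitInterval) (t : ℕ), t < T →
          ((σ.exchange ℓ R t).bits : ℝ) ≤ C * K * Real.log T) := by
  -- Two messages of K · `Nat.size t` bits each, with `Nat.size t` at most 4 log T.
  refine ⟨8, fun K T hK hT => ?_⟩
  have : NeZero K := ⟨by omega⟩
  have hK2 : (2 : ℝ) ≤ K := by exact_mod_cast hK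
  have hT1 : (1 : ℝ) ≤ T := by exact_mod_cast hT
  set P : ℝ := (K : ℝ) ^ (3 / 2 : ℝ) * √(T : ℝ) with hPdef
  have hP2 : P ^ 2 = K ^ 3 * T := by
    rw [hPdef, mul_pow, Real.sq_sqrt (by linarith), ← Real.rpow_natCast, ← Real.rpow_mul (by linarith)]
    norm_num
  have hP0 : 0 < P := by positivity
  -- Tight at K = 2. It gives T(K + 2)/P ≤ P/2, and P ≥ 2 absorbs the initial communication into the
  -- other half of P.
  have hK3 : (2 : ℝ) * (K + 2) ≤ K ^ 3 := by nlinarith [mul_nonneg (sub_nonneg.2 hK2) (sq_nonneg (K : ℝ))]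
  have hPtwo : 2 ≤ P := by nlinarith
  refine ⟨CommBandit.lazyStrategy (1 / P), fun ℓ hl => ⟨fun R t _ =>
    CommBandit.alice_ne_bob _ hK hl R t, ?_, ?_, fun R t ht => CommBandit.bits_le _ hK hl R ht⟩⟩
  · refine (CommBandit.regret_le (1 / P) (by positivity) hK hl T).trans ?_
    have h1 : 2 * Real.log K / (1 / P) + T * (31 / 2 * (1 / P) * K ^ 3) =
        (2 * Real.log K + 31 / 2) * P := by
      have : (T : ℝ) * (31 / 2 * (1 / P) * K ^ 3) = 31 / 2 * (K ^ 3 * T) / P := by ring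
      rw [this, ← hP2]
      field_simp
    have h2 : 2 ^ 9 * (K : ℝ) ^ (3 / 2 : ℝ) * Real.log K * √(T : ℝ) = 2 ^ 9 * Real.log K * P := by
      rw [hPdef]
      ring
    rw [h1, h2]
    have h3 : Real.log 2 ≤ Real.log K := Real.log_le_log (by norm_num) hK2
    have h4 := Real.log_two_gt_d9
    exact mul_le_mul_of_nonneg_right (by linarith) hP0.le
  · refine (CommBandit.expectedCommunications_le (1 / P) (by positivity) hK hl T).trans ?_
    have h1 : (T : ℝ) * (1 / P * (K + 2)) = T * (K + 2) / P := by ring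
    rw [h1, ← le_sub_iff_add_le', div_le_iff₀ hP0]
    nlinarith
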